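/- **Proposition (Approximation by the Average System).** Let $H\in\mathbb R^{n\times n}$ be symmetric positive definite, $\theta^*,h_1\in\mathbb R^n$ with $h_1\neq 0$, $J^*,h_0\in\mathbb R$, and $$J(\theta)=J^*+\tfrac12(\theta-\theta^*)^TH(\theta-\theta^*),\qquad h(\theta)=h_0+h_1^T(\theta-\theta^*).$$ Let $k,c,\delta,\omega_{\rm f}>0$, put $\max_\delta\{x\}=\tfrac12(x+\sqrt{x^2+\delta})$, and let $\omega_1',\dots,\omega_n'>0$ have rational ratios $\omega_i'/\omega_j'$, with $\omega_i'\ne\omega_j'$ for distinct $i,j$ and $\omega_i'+\omega_j'\neq\omega_l'$ for distinct $i,j,l$. For $a,\omega>0$ let $\omega_i=\omega\,\omega_i'$, $S_i(t)=a\sin(\omega_it)$, $M_i(t)=\frac2a\sin(\omega_it)$, and consider the ASfES system with state $\hat x=[\hat\theta;G_J;\eta_J;G_h;\eta_h;\gamma]\in\mathbb R^{3n+3}$: $$\begin{aligned} \dot{\hat\theta}&=-kG_J+\gamma\,{\textstyle\max_\delta}\{kG_J^TG_h-c\,\eta_h\}\,G_h,\\ \dot G_J&=-\omega_{\rm f}G_J+\omega_{\rm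 f}\bigl(J(\hat\theta+S(t))-\eta_J\bigr)M(t), & \dot\eta_J&=-\omega_{\rm f}\eta_J+\omega_{\rm f}J(\hat\theta+S(t)),\\ \dot G_h&=-\omega_{\rm f}G_h+\omega_{\rm f}\bigl(h(\hat\theta+S(t))-\eta_h\bigr)M(t), & \dot\eta_h&=-\omega_{\rm f}\eta_h+\omega_{\rm f}h(\hat\theta+S(t)),\\ \dot\gamma&=\omega_{\rm f}\gamma(1-\gamma\|G_h\|^2). \end{aligned}$$ Write $\theta(t)=\hat\theta(t)+S(t)$, $\tilde\theta=\hat\theta-\theta^*$ and $\tilde x=[\tilde\theta;G_J;\eta_J;G_h;\eta_h;\gamma]$, so that $\dot{\tilde x}=f(\tilde x,\omega t)$, where $f(\cdot,\tau)$ is the right-hand side above with $\hat\theta=\tilde\theta+\theta^*$ and with $S,M$ replaced by $a\sin(\omega_i'\tau)$, $\frac2a\sin(\omega_i'\tau)$. Let $\Pi=2\pi\,\mathrm{LCM}\{1/\omega_i'\}$ (the least common multiple being the least positive real that is an integer multiple of every $1/\omega_i'$), let $f^{\rm a}(x)=\frac1\Pi\int_0^\Pi f(x,\tau)\,d\tau$,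 and let the averaged system be $\dot x^{\rm a}=f^{\rm a}(x^{\rm a})$, with $x^{\rm a}=[\tilde\theta^{\rm a};G_J^{\rm a};\eta_J^{\rm a};G_h^{\rm a};\eta_h^{\rm a};\gamma^{\rm a}]$. With $q=h_1^TH^{-1}h_1$, $d=\frac{c\,q}{k\|h_1\|^2}$ and $R=\sqrt{h_0^2+\delta d/c^2}$, let $$x^{\rm a,e}=\Bigl[H^{-1}g;\ g;\ J^*+\tfrac{a^2}{4}\operatorname{Tr}H+\tfrac{(R-h_0)^2}{8q};\ h_1;\ \tfrac{h_0+R}{2};\ \tfrac1{\|h_1\|^2}\Bigr],\qquad g=\tfrac{R-h_0}{2q}\,h_1 .$$ There is a constant $K>0$, independent of $a$, such that the following holds for every $a>0$. 1. For every $x=[\tilde\theta;G_J;\eta_J;G_h;\eta_h;\gamma]$, $$f^{\rm a}(x)=\begin{bmatrix}-kG_J+\gamma\max_\delta\{kG_J^TG_h-c\,\eta_h\}G_h\\ -\omega_{\rm f}G_J+\omega_{\rm f}H\tilde\theta\\ -\omega_{\rm f}\eta_J+\omega_{\rm f}\bigl(J(\tilde\theta+\theta^*)+\frac{a^2}4\operatorname{Tr}H\bigr)\\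 -\omega_{\rm f}G_h+\omega_{\rm f}h_1\\ -\omega_{\rm f}\eta_h+\omega_{\rm f}h(\tilde\theta+\theta^*)\\ \omega_{\rm f}\gamma(1-\gamma\|G_h\|^2)\end{bmatrix}.$$ 2. $x^{\rm a,e}$ is an exponentially stable equilibrium of the averaged system: $f^{\rm a}(x^{\rm a,e})=0$, and there are $r,\kappa,\lambda>0$ such that from every $x_0$ with $\|x_0-x^{\rm a,e}\|<r$ the averaged system has a solution on $[0,\infty)$, and every such solution satisfies $\|x^{\rm a}(t)-x^{\rm a,e}\|\le\kappa\|x_0-x^{\rm a,e}\|e^{-\lambda t}$ for all $t\ge0$. 3. There are constants $\rho,\omega^*,C>0$ such that for every initial state with $\|\tilde x(0)-x^{\rm a,e}\|<\rho$ and every $\omega\ge\omega^*$, the ASfES system with this initial state and the averaged system with $x^{\rm a}(0)=\tilde x(0)$ have solutions on $[0,\infty)$, and all such solutions satisfy, for all $t\ge0$, $$\|x^{\rm a}(t)-\tilde x(t)\|\le \frac C\omega,\qquad \|\theta(t)-(\tilde\theta^{\rm a}(t)+\theta^*)\|\le K\Bigl(\frac1\omega+a\Bigr).$$ -/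

import Mathlib

namespace ASfES

noncomputable section

/-- The parameter space `ℝⁿ` with its Euclidean norm. -/
abbrev Vec (n : ℕ) : Type := EuclideanSpace ℝ (Fin n)

/-- The state space `ℝ^(3n+3)`, with the components in the order
`[θ ; G_J ; η_J ; G_h ; η_h ; γ]`. -/
abbrev State (n : ℕ) : Type := Vec n × Vec n × ℝ × Vec n × ℝ × ℝ

namespace State

variable {n : ℕ}

/-- The parameter component. -/
def param (x : State n) : Vec n := x.1
/-- The estimate of the gradient of the objective. -/
def gradJ (x : State n) : Vec n := x.2.1
/-- The filtered objective measurement. -/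
def etaJ (x : State n) : ℝ := x.2.2.1
/-- The estimate of the gradient of the barrier function. -/
def gradh (x : State n) : Vec n := x.2.2.2.1
/-- The filtered barrier measurement. -/
def etah (x : State n) : ℝ := x.2.2.2.2.1
/-- The Riccati filter state. -/
def gamma (x : State n) : ℝ := x.2.2.2.2.2

/-- The Euclidean norm of the stacked state vector in `ℝ^(3n+3)`
(the norm that Mathlib puts on a product is the maximum of the norms of the components). -/
def euclNorm (x : State n) : ℝ :=
  Real.sqrt (‖x.param‖ ^ 2 + ‖x.gradJ‖ ^ 2 + x.etaJ ^ 2 + ‖x.gradh‖ ^ 2 + x.etah ^ 2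
    + x.gamma ^ 2)

end State

/-- `max_δ{x} = (x + √(x² + δ)) / 2`. -/
def smoothMax (δ x : ℝ) : ℝ := (x + Real.sqrt (x ^ 2 + δ)) / 2

/-- The data of the problem other than the dither amplitude: the two maps `J` and `h` (through
their coefficients) and the design constants. No property is built in. -/
structure Data (n : ℕ) where
  /-- Hessian of the objective -/
  H : Matrix (Fin n) (Fin n) ℝ
  /-- unconstrained minimizer of the objective -/
  θstar : Vec n
  /-- unconstrained minimum of the objective -/
  Jstar : ℝ
  /-- value of the barrier function at the unconstrained minimizer -/
  h₀ : ℝ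
  /-- gradient of the barrier function -/
  h₁ : Vec n
  /-- adaptation gain -/
  k : ℝ
  /-- attractivity rate -/
  c : ℝ
  /-- smoothing parameter of the maximum -/
  δ : ℝ
  /-- filter gain -/
  ωf : ℝ
  /-- normalized dither frequencies; the actual frequencies are `ω * freq i` -/
  freq : Fin n → ℝ

namespace Data

variable {n : ℕ} (P : Data n)

/-- `J(θ) = J* + ½ (θ - θ*)ᵀ H (θ - θ*)`. -/
def J (θ : Vec n) : ℝ :=
  P.Jstar + 1 / 2 * inner ℝ (θ - P.θstar) (P.H.toEuclideanLin (θ - P.θstar))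

/-- `h(θ) = h₀ + h₁ᵀ (θ - θ*)`. -/
def h (θ : Vec n) : ℝ := P.h₀ + inner ℝ P.h₁ (θ - P.θstar)

end Data

/-- Perturbation signal `S_i(t) = a sin(w_i t)`. -/
def pert {n : ℕ} (a : ℝ) (w : Fin n → ℝ) (t : ℝ) : Vec n :=
  WithLp.toLp 2 fun i => a * Real.sin (w i * t)

/-- Demodulation signal `M_i(t) = (2 / a) sin(w_i t)`. -/
def demod {n : ℕ} (a : ℝ) (w : Fin n → ℝ) (t : ℝ) : Vec n :=
  WithLp.toLp 2 fun i => 2 / a * Real.sin (w i * t)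

namespace Data

variable {n : ℕ} (P : Data n)

/-- The right-hand side of the ASfES algorithm with dither amplitude `a` and frequencies `w`, at
time `t` and state `x̂ = [θ̂ ; G_J ; η_J ; G_h ; η_h ; γ]`. -/
def field (a : ℝ) (w : Fin n → ℝ) (t : ℝ) (x : State n) : State n :=
  (-(P.k • x.gradJ)
      + (x.gamma * smoothMax P.δ (P.k * inner ℝ x.gradJ x.gradh - P.c * x.etah)) • x.gradh,
   -(P.ωf • x.gradJ) + (P.ωf * (P.J (x.param + pert a w t) - x.etaJ)) • demod a w t,
   -(P.ωf * x.etaJ) + P.ωf * P.J (x.param + pert a w t),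
   -(P.ωf • x.gradh) + (P.ωf * (P.h (x.param + pert a w t) - x.etah)) • demod a w t,
   -(P.ωf * x.etah) + P.ωf * P.h (x.param + pert a w t),
   P.ωf * x.gamma * (1 - x.gamma * ‖x.gradh‖ ^ 2))

/-- Change of variables `x̂ ↦ x̃`: the parameter estimate `θ̂` is replaced by `θ̃ = θ̂ - θ*`. -/
def toError (x : State n) : State n := (x.param - P.θstar, x.2)

/-- The inverse change of variables `x̃ ↦ x̂`. -/
def ofError (x : State n) : State n := (x.param + P.θstar, x.2)

/-- The field `f(x̃, τ)` in the error coordinates and the fast time `τ = ω t`, so that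
`ω dx̃/dτ = f(x̃, τ)`. -/
def errorField (a τ : ℝ) (x : State n) : State n := P.field a P.freq τ (P.ofError x)

end Data

/-- Least common multiple of a family of positive reals: the least positive real that is an integer
multiple of every member. -/
def realLCM {n : ℕ} (v : Fin n → ℝ) : ℝ :=
  sInf {L : ℝ | 0 < L ∧ ∀ i, ∃ m : ℕ, L = m * v i}

namespace Data

variable {n : ℕ} (P : Data n)

/-- The averaging period `Π = 2π LCM {1 / ω'_i}`. -/
def period : ℝ := 2 * Real.pi * realLCM fun i => 1 / P.freq i

/-- The averaged field `fᵃ(x) = (1 / Π) ∫₀^Π f(x, τ) dτ`. -/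
def avgField (a : ℝ) (x : State n) : State n :=
  (1 / P.period) • ∫ τ in (0 : ℝ)..P.period, P.errorField a τ x

/-- The averaged field in closed form. -/
def avgFieldClosed (a : ℝ) (x : State n) : State n :=
  (-(P.k • x.gradJ)
      + (x.gamma * smoothMax P.δ (P.k * inner ℝ x.gradJ x.gradh - P.c * x.etah)) • x.gradh,
   -(P.ωf • x.gradJ) + P.ωf • P.H.toEuclideanLin x.param,
   -(P.ωf * x.etaJ) + P.ωf * (P.J (x.param + P.θstar) + a ^ 2 / 4 * P.H.trace),
   -(P.ωf • x.gradh) + P.ωf • P.h₁,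
   -(P.ωf * x.etah) + P.ωf * P.h (x.param + P.θstar),
   P.ωf * x.gamma * (1 - x.gamma * ‖x.gradh‖ ^ 2))

/-- The number `h₁ᵀ H⁻¹ h₁`. -/
def q : ℝ := inner ℝ P.h₁ (P.H⁻¹.toEuclideanLin P.h₁)

/-- The number `d = c h₁ᵀ H⁻¹ h₁ / (k ‖h₁‖²)`. -/
def d : ℝ := P.c / (P.k * ‖P.h₁‖ ^ 2) * P.q

/-- The number `√(h₀² + δ d / c²)`; it equals `|h₀| √(1 + δ d / (c² h₀²))` when `h₀ ≠ 0`, and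
extends that expression continuously to `h₀ = 0`. -/
def root : ℝ := Real.sqrt (P.h₀ ^ 2 + P.δ * P.d / P.c ^ 2)

/-- The equilibrium value of `G_J`. -/
def eqGradJ : Vec n := ((-P.h₀ + P.root) / (2 * P.q)) • P.h₁

/-- The constrained equilibrium of the averaged system. -/
def equilibrium (a : ℝ) : State n :=
  (P.H⁻¹.toEuclideanLin P.eqGradJ,
   P.eqGradJ,
   P.Jstar + a ^ 2 / 4 * P.H.trace + (-P.h₀ + P.root) ^ 2 / (8 * P.q),
   P.h₁,
   (P.h₀ + P.root) / 2,
   1 / ‖P.h₁‖ ^ 2)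

end Data

/-- `X` solves `dX/dt = F(t, X)` on `[0, ∞)`. -/
def IsSolution {n : ℕ} (F : ℝ → State n → State n) (X : ℝ → State n) : Prop :=
  ∀ t : ℝ, 0 ≤ t → HasDerivWithinAt X (F t (X t)) (Set.Ici 0) t

/-- `xe` is an exponentially stable equilibrium of `dX/dt = F(X)`: it is an equilibrium, and all
solutions from a neighbourhood of it exist for all `t ≥ 0` and decay to it exponentially, with an
overshoot proportional to the initial distance. -/
def IsExpStable {n : ℕ} (F : State n → State n) (xe : State n) : Prop :=
  F xe = 0 ∧
  ∃ r > 0, ∃ K > 0, ∃ lam > 0, ∀ x₀ : State n, (x₀ - xe).euclNorm < r →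
    (∃ X, IsSolution (fun _ => F) X ∧ X 0 = x₀) ∧
    ∀ X, IsSolution (fun _ => F) X → X 0 = x₀ →
      ∀ t : ℝ, 0 ≤ t →
        (X t - xe).euclNorm ≤ K * (x₀ - xe).euclNorm * Real.exp (-(lam * t))

end

end ASfES

/-!
The averaged field differs from the field `f(x, τ)` by a finite sum of products `φ(τ) G(x)`, where
`φ` is a trigonometric monomial of degree at most three minus its mean and `G` is smooth
(`isOscillatory_errorField_sub`). The sines and the products of three sines are odd, hence have
zero mean over the period; the products of two sines have mean `1 / 2` or `0`. Hence the closed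
form of the averaged field. Moreover `f - fᵃ` has a primitive in `τ` that is bounded together with
its derivative in `x`, uniformly in `τ` and locally uniformly in `x`.

The linearization of the averaged field at the equilibrium is a cascade. The filter for `G_h`,
the combination `η_h - h₁ᵀ H⁻¹ G_J` and then `γ` decay by themselves; they drive a second-order
system in `H⁻¹ G_J` which is a damped oscillator with positive definite mass and stiffness, because
the slope of the smooth maximum lies strictly between `0` and `1`; this drives `η_J`. Adding large
multiples of the Lyapunov functions of the driving subsystems gives a quadratic Lyapunov function
`B` of the whole linearization (`exists_lyapunov_fderiv_avgFieldClosed`).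

By strict differentiability `B` is also a contraction metric: `B(x - y, fᵃ x - fᵃ y)` is at most
`-μ ‖x - y‖²` for any two points near the equilibrium (`exists_isContractingAt`). Taking `y` to be
the equilibrium gives exponential stability. For averaging, let `X` and `Xa` solve the original and
the averaged system from the same state, and let `U` be the primitive of `f - fᵃ`. The corrected
difference `z = X - Xa - ω⁻¹ U(ω t, X)` starts at zero and satisfies
`dz/dt = fᵃ X - fᵃ Xa + O(1 / ω)`, so the contraction keeps it of order `1 / ω` for all times
(`exists_averaging_bound`). The estimate confines `X` to the ball in which it was derived, and a
smooth cutoff outside this ball provides global solutions (`exists_solvesWithin`).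

The constant `K` does not depend on `a`: the dither contributes at most `n a`, and the threshold for
`ω` may be taken so large that the averaging error is at most `a`.
-/

namespace ASfES

open Set Filter Topology Metric MeasureTheory
open scoped NNReal RealInnerProductSpace

/-! ### Global existence, comparison and continuation for ordinary differential equations -/

section ODE

variable {E : Type*} [NormedAddCommGroup E] [NormedSpace ℝ E]

/-- A bounded, globally Lipschitz vector field has solutions on the whole half-line. -/
theorem exists_hasDerivWithinAt_Ici [CompleteSpace E] {F : ℝ → E → E} {K L : ℝ≥0}
    (hK : ∀ t, LipschitzWith K (F t)) (hL : ∀ t x, ‖F t x‖ ≤ L)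
    (hc : ∀ x, Continuous fun t => F t x) (x₀ : E) :
    ∃ X : ℝ → E, X 0 = x₀ ∧
      ∀ t : ℝ, 0 ≤ t → HasDerivWithinAt X (F t (X t)) (Ici 0) t := by
  have hloc : ∀ N : ℕ, ∃ α : ℝ → E, α 0 = x₀ ∧
      ∀ t ∈ Icc (0 : ℝ) N, HasDerivWithinAt α (F t (α t)) (Icc (0 : ℝ) N) t := by
    intro N
    have hN : (0 : ℝ) ≤ N := N.cast_nonneg
    have hpl : IsPicardLindelof F (⟨0, le_rfl, hN⟩ : Icc (0 : ℝ) N) x₀ (L * N) 0 L K :=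
      { lipschitzOnWith := fun t _ => (hK t).lipschitzOnWith
        continuousOn := fun x _ => (hc x).continuousOn
        norm_le := fun t _ x _ => hL t x
        mul_max_le := by simp }
    exact hpl.exists_eq_forall_mem_Icc_hasDerivWithinAt₀
  choose α hα0 hα using hloc
  have hIci : ∀ N : ℕ, ∀ t ∈ Ico (0 : ℝ) N, HasDerivWithinAt (α N) (F t (α N t)) (Ici 0) t := by
    intro N t ht
    refine (hα N t (Ico_subset_Icc_self ht)).mono_of_mem_nhdsWithin ?_
    filter_upwards [self_mem_nhdsWithin, mem_nhdsWithin_of_mem_nhds (Iio_mem_nhds ht.2)]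
      with s hs1 hs2 using ⟨hs1, le_of_lt hs2⟩
  have hagree : ∀ N M : ℕ, N ≤ M → EqOn (α N) (α M) (Icc (0 : ℝ) N) := by
    intro N M hNM
    have hNM' : (N : ℝ) ≤ M := by exact_mod_cast hNM
    refine ODE_solution_unique (v := F) hK ?_ ?_ ?_ ?_ ((hα0 N).trans (hα0 M).symm)
    · exact fun t ht => (hα N t ht).continuousWithinAt
    · exact fun t ht => (hIci N t ht).mono (Ici_subset_Ici.2 ht.1)
    · exact fun t ht => ((hα M t ⟨ht.1, ht.2.trans hNM'⟩).continuousWithinAt).mono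
        (Icc_subset_Icc_right hNM')
    · exact fun t ht => (hIci M t ⟨ht.1, ht.2.trans_le hNM'⟩).mono (Ici_subset_Ici.2 ht.1)
  refine ⟨fun t => α (⌊t⌋₊ + 1) t, by simp [hα0], fun t ht => ?_⟩
  have hlt : ∀ s : ℝ, s < (⌊s⌋₊ + 1 : ℕ) := fun s => by push_cast; exact Nat.lt_floor_add_one s
  have hev : ∀ s ∈ Ici (0 : ℝ), s < t + 1 → α (⌊s⌋₊ + 1) s = α (⌊t⌋₊ + 2) s := by
    intro s hs hst
    refine hagree _ _ ?_ ⟨hs, (hlt s).le⟩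
    have : ⌊s⌋₊ ≤ ⌊t + 1⌋₊ := Nat.floor_mono hst.le
    rw [Nat.floor_add_one ht] at this
    omega
  have hder := hIci (⌊t⌋₊ + 2) t ⟨ht, (hlt t).trans_le (by push_cast; linarith)⟩
  rw [← hev t ht (by linarith)] at hder
  refine hder.congr_of_eventuallyEq ?_ (hev t ht (by linarith))
  filter_upwards [self_mem_nhdsWithin, mem_nhdsWithin_of_mem_nhds (Iio_mem_nhds (lt_add_one t))]
    with s hs1 hs2 using hev s hs1 hs2

/-- Grönwall's inequality with a negative rate: the solution of `V' ≤ -lam V + b` stays below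
`V 0 e^(-lam T) + b / lam`, uniformly in `T`. -/
theorem le_of_deriv_le_neg_mul_add {V V' : ℝ → ℝ} {lam b T : ℝ} (hlam : 0 < lam) (hb : 0 ≤ b)
    (hT : 0 ≤ T) (hV : ∀ t ∈ Icc 0 T, HasDerivWithinAt V (V' t) (Ici 0) t)
    (hle : ∀ t ∈ Icc 0 T, V' t ≤ -lam * V t + b) :
    V T ≤ V 0 * Real.exp (-(lam * T)) + b / lam := by
  have h := le_gronwallBound_of_liminf_deriv_right_le (f := V) (f' := V') (δ := V 0) (K := -lam)
    (ε := b) (a := 0) (b := T)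
    (fun t ht => (hV t ht).continuousWithinAt.mono Icc_subset_Ici_self)
    (fun t ht r hr => ((hV t (Ico_subset_Icc_self ht)).mono
      (Ici_subset_Ici.2 ht.1)).liminf_right_slope_le hr)
    le_rfl (fun t ht => hle t (Ico_subset_Icc_self ht)) T ⟨hT, le_rfl⟩
  rw [gronwallBound_of_K_ne_0 (neg_ne_zero.2 hlam.ne')] at h
  simp only [sub_zero, neg_mul] at h
  have h2 : 0 ≤ b / lam * Real.exp (-(lam * T)) := by positivity
  have h3 : b / -lam * (Real.exp (-(lam * T)) - 1)
      = b / lam - b / lam * Real.exp (-(lam * T)) := by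
    rw [div_neg]; ring
  linarith

/-- Continuation principle: a bound that improves itself on every initial interval holds for all
times. -/
theorem forall_lt_of_bootstrap {φ : ℝ → ℝ} (hφ : ContinuousOn φ (Ici 0)) {r : ℝ} (h0 : φ 0 < r)
    (h : ∀ T, 0 ≤ T → (∀ t ∈ Icc 0 T, φ t ≤ r) → φ T < r) : ∀ t, 0 ≤ t → φ t < r := by
  by_contra! hcon
  obtain ⟨t₁, ht₁, hrt₁⟩ := hcon
  -- `T` is the first time at which the bound fails
  have hcomp : IsCompact (Icc 0 t₁ ∩ φ ⁻¹' Ici r) := by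
    refine isCompact_Icc.of_isClosed_subset ?_ inter_subset_left
    exact (hφ.mono Icc_subset_Ici_self).preimage_isClosed_of_isClosed isClosed_Icc isClosed_Ici
  obtain ⟨T, ⟨hT, hTr⟩, hmin⟩ := hcomp.exists_isLeast ⟨t₁, ⟨ht₁, le_rfl⟩, hrt₁⟩
  have hbefore : ∀ t ∈ Ico 0 T, φ t < r := by
    intro t ht
    by_contra! hc
    exact absurd (hmin ⟨⟨ht.1, ht.2.le.trans hT.2⟩, hc⟩) (not_le.2 ht.2)
  have hT0 : 0 < T := by
    rcases hT.1.eq_or_lt with h' | h'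
    · rw [← h'] at hTr; exact absurd h0 (not_lt.2 hTr)
    · exact h'
  have hle : ∀ t ∈ Icc 0 T, φ t ≤ r := by
    have hcl : Icc 0 T ⊆ closure (Ico 0 T) := by rw [closure_Ico hT0.ne]
    intro t ht
    have hcont : ContinuousWithinAt φ (Ico 0 T) t :=
      (hφ t ht.1).mono (Ico_subset_Icc_self.trans Icc_subset_Ici_self)
    exact hcont.closure_le (hcl ht) continuousWithinAt_const fun y hy => (hbefore y hy).le
  exact absurd (h T hT.1 hle) (not_lt.2 hTr)

end ODE

/-! ### Contraction near an equilibrium, exponential stability and averaging -/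

section Contraction

variable {E : Type*} [NormedAddCommGroup E] [NormedSpace ℝ E]

/-- `X` is continuous on `[0, ∞)` and satisfies `dX/dt = F(t, X)` at the times when it lies in `s`.
Both the solutions of `F` and those of a field that agrees with `F` on `s` have this property. -/
def SolvesWithin (F : ℝ → E → E) (s : Set E) (X : ℝ → E) : Prop :=
  ContinuousOn X (Ici 0) ∧
    ∀ t : ℝ, 0 ≤ t → X t ∈ s → HasDerivWithinAt X (F t (X t)) (Ici 0) t

theorem SolvesWithin.of_forall {F : ℝ → E → E} {X : ℝ → E}
    (hX : ∀ t : ℝ, 0 ≤ t → HasDerivWithinAt X (F t (X t)) (Ici 0) t) (s : Set E) :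
    SolvesWithin F s X :=
  ⟨fun t ht => (hX t ht).continuousWithinAt, fun t ht _ => hX t ht⟩

/-- `A` vanishes at `xe` and contracts, at rate `μ` in the inner product `B`, the distance between
any two points of the closed ball of radius `r` around `xe`, where `A` is also `L`-Lipschitz. The
constant `m` compares `B` with the norm. -/
structure IsContractingAt (A : E → E) (xe : E) (B : E →L[ℝ] E →L[ℝ] ℝ) (r m μ L : ℝ) : Prop where
  r_pos : 0 < r
  m_pos : 0 < m
  mu_pos : 0 < μ
  L_nonneg : 0 ≤ L
  equilibrium : A xe = 0
  symm : ∀ x y, B x y = B y x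
  coercive : ∀ x, m * ‖x‖ ^ 2 ≤ B x x
  contract : ∀ x ∈ closedBall xe r, ∀ y ∈ closedBall xe r,
    B (x - y) (A x - A y) ≤ -μ * ‖x - y‖ ^ 2
  lipschitz : ∀ x ∈ closedBall xe r, ∀ y ∈ closedBall xe r, ‖A x - A y‖ ≤ L * ‖x - y‖

theorem abs_bilin_le (B : E →L[ℝ] E →L[ℝ] ℝ) (x y : E) : |B x y| ≤ ‖B‖ * ‖x‖ * ‖y‖ :=
  B.le_opNorm₂ x y

/-- A Lyapunov form of the linearization is a contraction metric near the equilibrium, because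
strict differentiability controls `A x - A y` for two nearby points. -/
theorem exists_isContractingAt {A : E → E} {xe : E} {L : E →L[ℝ] E}
    (hA : HasStrictFDerivAt A L xe) (h0 : A xe = 0) {B : E →L[ℝ] E →L[ℝ] ℝ} {m : ℝ} (hm : 0 < m)
    (hsymm : ∀ x y, B x y = B y x) (hco : ∀ x, m * ‖x‖ ^ 2 ≤ B x x)
    (hL : ∀ x, B x (L x) ≤ -m * ‖x‖ ^ 2) :
    ∃ r μ K, IsContractingAt A xe B r m μ K := by
  set ε : ℝ := m / (2 * (‖B‖ + 1)) with hε
  have hBpos : 0 < ‖B‖ + 1 := by positivity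
  have hεpos : 0 < ε := by positivity
  have hB : ‖B‖ * ε ≤ m / 2 := by
    rw [hε, mul_div_assoc', div_le_div_iff₀ (by positivity) two_pos]
    nlinarith [norm_nonneg B]
  have hev := hA.isLittleO.def hεpos
  rw [Metric.eventually_nhds_iff] at hev
  obtain ⟨d, hd, hball⟩ := hev
  have key : ∀ x ∈ closedBall xe (d / 2), ∀ y ∈ closedBall xe (d / 2),
      ‖A x - A y - L (x - y)‖ ≤ ε * ‖x - y‖ := by
    intro x hx y hy
    refine @hball (x, y) ?_
    rw [Prod.dist_eq, max_lt_iff]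
    rw [mem_closedBall] at hx hy
    constructor <;> linarith
  refine ⟨d / 2, m / 2, ε + ‖L‖, ⟨by positivity, hm, by positivity, by positivity, h0, hsymm, hco,
    fun x hx y hy => ?_, fun x hx y hy => ?_⟩⟩
  · have h1 := key x hx y hy
    have h2 : B (x - y) (A x - A y)
        = B (x - y) (L (x - y)) + B (x - y) (A x - A y - L (x - y)) := by
      rw [← map_add]; congr 1; abel
    have h3 := (le_abs_self _).trans (abs_bilin_le B (x - y) (A x - A y - L (x - y)))
    have h4 : ‖B‖ * ‖x - y‖ * ‖A x - A y - L (x - y)‖ ≤ ‖B‖ * ‖x - y‖ * (ε * ‖x - y‖) := by gcongr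
    have h5 : ‖B‖ * ε * ‖x - y‖ ^ 2 ≤ m / 2 * ‖x - y‖ ^ 2 := by gcongr
    nlinarith [hL (x - y)]
  · have h1 := key x hx y hy
    have h2 : A x - A y = (A x - A y - L (x - y)) + L (x - y) := by abel
    rw [h2]
    calc _ ≤ _ := norm_add_le _ _
      _ ≤ ε * ‖x - y‖ + ‖L‖ * ‖x - y‖ := add_le_add h1 (L.le_opNorm _)
      _ = _ := by ring

theorem hasDerivWithinAt_bilin_self {B : E →L[ℝ] E →L[ℝ] ℝ} (hsymm : ∀ x y, B x y = B y x)
    {z : ℝ → E} {z' : E} {s : Set ℝ} {t : ℝ} (hz : HasDerivWithinAt z z' s t) :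
    HasDerivWithinAt (fun t => B (z t) (z t)) (2 * B (z t) z') s t := by
  have h := (B.hasFDerivAt.comp_hasDerivWithinAt t hz).clm_apply hz
  refine h.congr_deriv ?_
  rw [hsymm z']; simp; ring

namespace IsContractingAt

variable {A : E → E} {xe : E} {B : E →L[ℝ] E →L[ℝ] ℝ} {r m μ L : ℝ}

theorem bilin_le (x : E) : B x x ≤ (‖B‖ + 1) * ‖x‖ ^ 2 := by
  have := (le_abs_self _).trans (abs_bilin_le B x x)
  nlinarith [sq_nonneg ‖x‖]

theorem norm_le_of_bilin_le (h : IsContractingAt A xe B r m μ L) {x : E} {c : ℝ}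
    (hx : B x x ≤ c) : ‖x‖ ≤ Real.sqrt (c / m) := by
  apply Real.le_sqrt_of_sq_le
  rw [le_div_iff₀ h.m_pos]
  linarith [h.coercive x]

/-- Trajectories that start close to the equilibrium stay in the ball and decay exponentially. -/
theorem exists_expDecay (h : IsContractingAt A xe B r m μ L) :
    ∃ ρ > 0, ∃ κ > 0, ∃ lam > 0, ∀ X : ℝ → E, SolvesWithin (fun _ => A) (closedBall xe r) X →
      ‖X 0 - xe‖ < ρ → ∀ t, 0 ≤ t →
        ‖X t - xe‖ ≤ r / 2 ∧ ‖X t - xe‖ ≤ κ * ‖X 0 - xe‖ * Real.exp (-(lam * t)) := by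
  have hr := h.r_pos
  have hm := h.m_pos
  have hμ := h.mu_pos
  have hb : 0 < ‖B‖ + 1 := by positivity
  set κ : ℝ := Real.sqrt ((‖B‖ + 1) / m) with hκ
  have hκpos : 0 < κ := Real.sqrt_pos.2 (by positivity)
  set lam : ℝ := 2 * μ / (‖B‖ + 1) with hlam
  have hlampos : 0 < lam := by positivity
  -- the initial radius is such that the overshoot `κ ‖X 0 - xe‖` is at most `r / 2`
  refine ⟨r / (2 * (κ + 1)), by positivity, κ, hκpos, lam / 2, by positivity,
    fun X hX hX0 => ?_⟩
  have step : ∀ T, 0 ≤ T → (∀ t ∈ Icc 0 T, ‖X t - xe‖ ≤ r) →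
      ‖X T - xe‖ ≤ κ * ‖X 0 - xe‖ * Real.exp (-(lam / 2 * T)) := by
    intro T hT hin
    have hmem : ∀ t ∈ Icc 0 T, X t ∈ closedBall xe r := fun t ht => by
      rw [mem_closedBall, dist_eq_norm]; exact hin t ht
    have hder : ∀ t ∈ Icc 0 T, HasDerivWithinAt (fun t => B (X t - xe) (X t - xe))
        (2 * B (X t - xe) (A (X t))) (Ici 0) t := fun t ht =>
      hasDerivWithinAt_bilin_self h.symm ((hX.2 t ht.1 (hmem t ht)).sub_const xe)
    have hle := le_of_deriv_le_neg_mul_add hlampos le_rfl hT hder (fun t ht => by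
      have h1 := h.contract _ (hmem t ht) xe (mem_closedBall_self hr.le)
      rw [h.equilibrium, sub_zero] at h1
      have h2 := bilin_le (B := B) (X t - xe)
      have h3 : lam * B (X t - xe) (X t - xe) ≤ lam * ((‖B‖ + 1) * ‖X t - xe‖ ^ 2) := by gcongr
      have h4 : lam * ((‖B‖ + 1) * ‖X t - xe‖ ^ 2) = 2 * μ * ‖X t - xe‖ ^ 2 := by
        rw [hlam]; field_simp
      linarith)
    rw [zero_div, add_zero] at hle
    have h5 := h.norm_le_of_bilin_le (hle.trans
      (mul_le_mul_of_nonneg_right (bilin_le (B := B) (X 0 - xe)) (Real.exp_pos _).le))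
    refine h5.trans_eq ?_
    have h6 : Real.exp (-(lam * T)) = Real.exp (-(lam / 2 * T)) ^ 2 := by
      rw [← Real.exp_nat_mul]; congr 1; push_cast; ring
    rw [h6, show (‖B‖ + 1) * ‖X 0 - xe‖ ^ 2 * Real.exp (-(lam / 2 * T)) ^ 2 / m
        = (‖B‖ + 1) / m * (‖X 0 - xe‖ * Real.exp (-(lam / 2 * T))) ^ 2 by ring,
      Real.sqrt_mul (by positivity), Real.sqrt_sq (by positivity), ← hκ]
    ring
  have hhalf : ∀ s : ℝ, 0 ≤ s → κ * ‖X 0 - xe‖ * Real.exp (-(lam / 2 * s)) ≤ r / 2 := by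
    intro s hs
    have h1 : Real.exp (-(lam / 2 * s)) ≤ 1 := by
      rw [Real.exp_le_one_iff]; simp only [Left.neg_nonpos_iff]; positivity
    have h2 : κ * ‖X 0 - xe‖ ≤ r / 2 := by
      have h3 : ‖X 0 - xe‖ * (2 * (κ + 1)) < r := (lt_div_iff₀ (by positivity)).1 hX0
      nlinarith [norm_nonneg (X 0 - xe)]
    calc _ ≤ κ * ‖X 0 - xe‖ * 1 := by gcongr
      _ ≤ _ := by linarith
  have hstay := forall_lt_of_bootstrap (φ := fun t => ‖X t - xe‖) (r := r)
    ((hX.1.sub continuousOn_const).norm)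
    (hX0.trans_le (div_le_self hr.le (by linarith)))
    (fun T hT hin => (step T hT hin).trans_lt ((hhalf T hT).trans_lt (by linarith)))
  intro t ht
  have h1 := step t ht fun s hs => (hstay s hs.1).le
  exact ⟨h1.trans (hhalf t ht), h1⟩

/-- The dissipation inequality for the corrected difference `D - u`, when the correction `u` and
the remainder `v` are both of size `ε`. -/
theorem bilin_dissipation (h : IsContractingAt A xe B r m μ L) {D F u v : E} {C N ε : ℝ}
    (hC : 0 ≤ C) (hε : 0 ≤ ε) (hu : ‖u‖ ≤ C * ε) (hv : ‖v‖ ≤ N * ε)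
    (hF : ‖F‖ ≤ L * ‖D‖) (hcon : B D F ≤ -μ * ‖D‖ ^ 2) :
    2 * B (D - u) (F - v) ≤ -(μ / (2 * (‖B‖ + 1))) * B (D - u) (D - u)
      + 2 * (μ / 2 * C ^ 2 + ((‖B‖ + 1) * (C * L + N)) ^ 2 / (2 * μ) + (‖B‖ + 1) * N * C)
        * ε ^ 2 := by
  have hμ := h.mu_pos
  have hL := h.L_nonneg
  have hb : 0 < ‖B‖ + 1 := by positivity
  have hbB : ‖B‖ ≤ ‖B‖ + 1 := by linarith
  have hD := norm_nonneg D
  have hzD : ‖D - u‖ ≤ ‖D‖ + C * ε := (norm_sub_le _ _).trans (by linarith)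
  have hexp : B (D - u) (F - v) = B D F - B u F - B (D - u) v := by
    rw [map_sub]; simp
  have h1 : -B u F ≤ (‖B‖ + 1) * (C * ε) * (L * ‖D‖) := by
    refine (neg_le_abs _).trans ((abs_bilin_le B u F).trans ?_)
    gcongr
  have h2 : -B (D - u) v ≤ (‖B‖ + 1) * (‖D‖ + C * ε) * (N * ε) := by
    refine (neg_le_abs _).trans ((abs_bilin_le B (D - u) v).trans ?_)
    gcongr
  have hBz : μ / (2 * (‖B‖ + 1)) * B (D - u) (D - u) ≤ μ / 2 * ‖D - u‖ ^ 2 := by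
    calc _ ≤ μ / (2 * (‖B‖ + 1)) * ((‖B‖ + 1) * ‖D - u‖ ^ 2) := by
          gcongr; exact bilin_le (B := B) _
      _ = _ := by field_simp
  have hz2 : ‖D - u‖ ^ 2 ≤ 2 * ‖D‖ ^ 2 + 2 * (C * ε) ^ 2 := by
    have : ‖D - u‖ ^ 2 ≤ (‖D‖ + C * ε) ^ 2 := by gcongr
    linarith [sq_nonneg (‖D‖ - C * ε)]
  generalize hb' : ‖B‖ + 1 = b at *
  set p : ℝ := b * (C * L + N) with hp
  have hyoung : p * ε * ‖D‖ ≤ μ / 2 * ‖D‖ ^ 2 + p ^ 2 / (2 * μ) * ε ^ 2 := by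
    have : μ / 2 * ‖D‖ ^ 2 + p ^ 2 / (2 * μ) * ε ^ 2 - p * ε * ‖D‖
        = (μ * ‖D‖ - p * ε) ^ 2 / (2 * μ) := by field_simp; ring
    have h' : 0 ≤ (μ * ‖D‖ - p * ε) ^ 2 / (2 * μ) := by positivity
    linarith
  have hz3 : μ / 2 * ‖D - u‖ ^ 2 ≤ μ / 2 * (2 * ‖D‖ ^ 2 + 2 * (C * ε) ^ 2) := by gcongr
  have hexp2 : b * (C * ε) * (L * ‖D‖) + b * (‖D‖ + C * ε) * (N * ε)
      = p * ε * ‖D‖ + b * N * C * ε ^ 2 := by rw [hp]; ring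
  rw [hexp]
  linarith

/-- The averaging estimate on the whole half-line. The perturbation `g (ω t) x` has the bounded
primitive `ω⁻¹ U (ω t) x`; subtracting it from the difference `X - Xa` leaves a quantity whose
derivative is `A X - A Xa` up to `O(1 / ω)`, so that the contraction of `A` keeps it `O(1 / ω)`. -/
theorem exists_averaging_bound (h : IsContractingAt A xe B r m μ L) {g U : ℝ → E → E}
    {U' : ℝ → E → E →L[ℝ] E} {C : ℝ} (hC : 0 ≤ C)
    (hU : ∀ τ x, HasFDerivAt (fun p : ℝ × E => U p.1 p.2)
      ((ContinuousLinearMap.toSpanSingleton ℝ (g τ x)).coprod (U' τ x)) (τ, x))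
    (hU0 : ∀ x, U 0 x = 0)
    (hbd : ∀ τ, ∀ x ∈ closedBall xe r, ‖g τ x‖ ≤ C ∧ ‖U τ x‖ ≤ C ∧ ‖U' τ x‖ ≤ C) :
    ∃ ωs > 0, ∃ C' > 0, ∀ ω, ωs ≤ ω → ∀ X Xa : ℝ → E,
      SolvesWithin (fun t x => A x + g (ω * t) x) (closedBall xe r) X →
      SolvesWithin (fun _ => A) (closedBall xe r) Xa → X 0 = Xa 0 →
      (∀ t, 0 ≤ t → ‖Xa t - xe‖ ≤ r / 2) →
      ∀ t, 0 ≤ t → ‖X t - xe‖ ≤ r ∧ ‖Xa t - X t‖ ≤ C' / ω := by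
  have hr := h.r_pos
  have hm := h.m_pos
  have hμ := h.mu_pos
  have hL := h.L_nonneg
  have hb : 0 < ‖B‖ + 1 := by positivity
  set b := ‖B‖ + 1
  set lam : ℝ := μ / (2 * b) with hlam
  have hlampos : 0 < lam := by positivity
  -- `N` bounds `U' (A X + g)` on the ball, and `q` is the constant of `bilin_dissipation`
  set N : ℝ := C * (L * r + C) with hN
  have hN0 : 0 ≤ N := by positivity
  set p : ℝ := b * (C * L + N) with hp
  set q : ℝ := μ / 2 * C ^ 2 + p ^ 2 / (2 * μ) + b * N * C with hq
  have hq0 : 0 ≤ q := by positivity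
  set C' : ℝ := Real.sqrt (2 * q / lam / m) + C + 1 with hC'
  have hC'pos : 0 < C' := by positivity
  -- the threshold makes the error `C' / ω` at most `r / 4`, so that `X` cannot leave the ball
  refine ⟨4 * C' / r, by positivity, C', hC'pos, fun ω hω X Xa hX hXa h0 hXar => ?_⟩
  have hωpos : 0 < ω := lt_of_lt_of_le (by positivity) hω
  have hXamem : ∀ t, 0 ≤ t → Xa t ∈ closedBall xe r := fun t ht => by
    rw [mem_closedBall, dist_eq_norm]; linarith [hXar t ht]
  have step : ∀ T, 0 ≤ T → (∀ t ∈ Icc 0 T, ‖X t - xe‖ ≤ r) → ‖X T - Xa T‖ ≤ C' / ω := by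
    intro T hT hin
    have hmem : ∀ t ∈ Icc 0 T, X t ∈ closedBall xe r := fun t ht => by
      rw [mem_closedBall, dist_eq_norm]; exact hin t ht
    set z : ℝ → E := fun t => X t - Xa t - ω⁻¹ • U (ω * t) (X t) with hz
    have hzder : ∀ t ∈ Icc 0 T, HasDerivWithinAt z (A (X t) - A (Xa t)
        - ω⁻¹ • U' (ω * t) (X t) (A (X t) + g (ω * t) (X t))) (Ici 0) t := by
      intro t ht
      have hX' := hX.2 t ht.1 (hmem t ht)
      have hlin : HasDerivWithinAt (fun t : ℝ => ω * t) ω (Ici 0) t := by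
        simpa using ((hasDerivAt_id t).const_mul ω).hasDerivWithinAt
      have hUd := (hU (ω * t) (X t)).comp_hasDerivWithinAt t (hlin.prodMk hX')
      have := (hX'.sub (hXa.2 t ht.1 (hXamem t ht.1))).sub (hUd.const_smul ω⁻¹)
      refine this.congr_deriv ?_
      simp only [ContinuousLinearMap.coprod_apply, ContinuousLinearMap.toSpanSingleton_apply,
        smul_add, smul_smul, inv_mul_cancel₀ hωpos.ne', one_smul]
      abel
    have hWle : ∀ t ∈ Icc 0 T, 2 * B (z t) (A (X t) - A (Xa t)
        - ω⁻¹ • U' (ω * t) (X t) (A (X t) + g (ω * t) (X t)))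
        ≤ -lam * B (z t) (z t) + 2 * q * ω⁻¹ ^ 2 := by
      intro t ht
      obtain ⟨hg1, hU1, hU1'⟩ := hbd (ω * t) (X t) (hmem t ht)
      set ε := ω⁻¹ with hε
      have hεpos : 0 < ε := inv_pos.2 hωpos
      set u := ε • U (ω * t) (X t) with hu
      set nn := ε • U' (ω * t) (X t) (A (X t) + g (ω * t) (X t)) with hnn
      set D := X t - Xa t
      set F := A (X t) - A (Xa t)
      have hun : ‖u‖ ≤ C * ε := by
        rw [hu, norm_smul, Real.norm_of_nonneg hεpos.le, mul_comm]; gcongr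
      have hAX : ‖A (X t)‖ ≤ L * r := by
        have h1 := h.lipschitz _ (hmem t ht) xe (mem_closedBall_self hr.le)
        rw [h.equilibrium, sub_zero] at h1
        exact h1.trans (by gcongr; exact hin t ht)
      have hnnn : ‖nn‖ ≤ N * ε := by
        rw [hnn, norm_smul, Real.norm_of_nonneg hεpos.le, mul_comm]
        gcongr
        calc _ ≤ ‖U' (ω * t) (X t)‖ * ‖A (X t) + g (ω * t) (X t)‖ :=
              ContinuousLinearMap.le_opNorm _ _
          _ ≤ C * (L * r + C) := by
              gcongr; exact (norm_add_le _ _).trans (add_le_add hAX hg1)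
      have hFn : ‖F‖ ≤ L * ‖D‖ := h.lipschitz _ (hmem t ht) _ (hXamem t ht.1)
      have hcon : B D F ≤ -μ * ‖D‖ ^ 2 := h.contract _ (hmem t ht) _ (hXamem t ht.1)
      exact h.bilin_dissipation hC hεpos.le hun hnnn hFn hcon
    have hW := le_of_deriv_le_neg_mul_add hlampos (by positivity) hT
      (fun t ht => hasDerivWithinAt_bilin_self h.symm (hzder t ht)) hWle
    have hz0 : z 0 = 0 := by simp [hz, h0, hU0]
    rw [hz0, map_zero, zero_mul, zero_add] at hW
    have hzT := h.norm_le_of_bilin_le hW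
    have hsq : Real.sqrt (2 * q * ω⁻¹ ^ 2 / lam / m) = Real.sqrt (2 * q / lam / m) * ω⁻¹ := by
      rw [show 2 * q * ω⁻¹ ^ 2 / lam / m = 2 * q / lam / m * ω⁻¹ ^ 2 by ring,
        Real.sqrt_mul (by positivity), Real.sqrt_sq (by positivity)]
    rw [hsq] at hzT
    have hUT := (hbd (ω * T) (X T) (hmem T ⟨hT, le_rfl⟩)).2.1
    have hDT : X T - Xa T = z T + ω⁻¹ • U (ω * T) (X T) := by simp [hz]
    rw [hDT]
    refine (norm_add_le _ _).trans ?_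
    rw [norm_smul, Real.norm_of_nonneg (by positivity : (0 : ℝ) ≤ ω⁻¹), div_eq_mul_inv, hC']
    have : ω⁻¹ * ‖U (ω * T) (X T)‖ ≤ ω⁻¹ * C := by gcongr
    have : 0 < ω⁻¹ := by positivity
    nlinarith
  have hsmall : C' / ω ≤ r / 4 := by
    rw [div_le_div_iff₀ hωpos (by norm_num)]
    rw [div_le_iff₀ hr] at hω
    linarith
  have htri : ∀ t, 0 ≤ t → ‖X t - xe‖ ≤ ‖X t - Xa t‖ + r / 2 := fun t ht => by
    have : X t - xe = (X t - Xa t) + (Xa t - xe) := by abel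
    rw [this]
    exact (norm_add_le _ _).trans (by linarith [hXar t ht])
  have hstay := forall_lt_of_bootstrap (φ := fun t => ‖X t - xe‖) (r := r)
    ((hX.1.sub continuousOn_const).norm)
    (by have := hXar 0 le_rfl; rw [← h0] at this; linarith)
    (fun T hT hin => by linarith [step T hT hin, htri T hT])
  intro t ht
  exact ⟨(hstay t ht).le, by rw [norm_sub_rev]; exact step t ht fun s hs => (hstay s hs.1).le⟩

end IsContractingAt

end Contraction

/-! ### Oscillatory perturbations with zero mean -/

/-- A continuous `p`-periodic function with integral zero over a period. -/
structure IsZeroMean (p : ℝ) (φ : ℝ → ℝ) : Prop where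
  continuous : Continuous φ
  periodic : Function.Periodic φ p
  integral_eq_zero : ∫ t in (0 : ℝ)..p, φ t = 0

namespace IsZeroMean

variable {p : ℝ} {φ ψ : ℝ → ℝ}

theorem add (hφ : IsZeroMean p φ) (hψ : IsZeroMean p ψ) :
    IsZeroMean p (fun t => φ t + ψ t) where
  continuous := hφ.continuous.add hψ.continuous
  periodic t := by simp only [hφ.periodic t, hψ.periodic t]
  integral_eq_zero := by
    rw [intervalIntegral.integral_add (hφ.continuous.intervalIntegrable _ _)
      (hψ.continuous.intervalIntegrable _ _), hφ.integral_eq_zero, hψ.integral_eq_zero, add_zero]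

theorem const_mul (hφ : IsZeroMean p φ) (c : ℝ) : IsZeroMean p (fun t => c * φ t) where
  continuous := hφ.continuous.const_mul c
  periodic t := by simp only [hφ.periodic t]
  integral_eq_zero := by
    rw [intervalIntegral.integral_const_mul, hφ.integral_eq_zero, mul_zero]

theorem of_odd (hc : Continuous φ) (hp : Function.Periodic φ p) (hodd : ∀ t, φ (-t) = -φ t) :
    IsZeroMean p φ where
  continuous := hc
  periodic := hp
  integral_eq_zero := by
    have h1 : ∫ t in (0 : ℝ)..p, φ (-t) = -∫ t in (0 : ℝ)..p, φ t := by
      simp only [hodd, intervalIntegral.integral_neg]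
    have h2 := hp.intervalIntegral_add_eq (-p) 0
    rw [neg_add_cancel, zero_add] at h2
    rw [intervalIntegral.integral_comp_neg, neg_zero, h2] at h1
    linarith

theorem exists_bound (hp : p ≠ 0) (hφ : IsZeroMean p φ) : ∃ C, ∀ t, |φ t| ≤ C := by
  obtain ⟨C, hC⟩ := (hφ.periodic.isBounded_of_continuous hp hφ.continuous).exists_norm_le
  exact ⟨C, fun t => hC _ ⟨t, rfl⟩⟩

/-- A zero-mean periodic function has a bounded primitive, since the primitive is periodic. -/
theorem exists_primitive (hp : p ≠ 0) (hφ : IsZeroMean p φ) :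
    ∃ Φ : ℝ → ℝ, Φ 0 = 0 ∧ (∀ t, HasDerivAt Φ (φ t) t) ∧ ∃ C, ∀ t, |Φ t| ≤ C := by
  have hder : ∀ t, HasDerivAt (fun u => ∫ s in (0 : ℝ)..u, φ s) (φ t) t := fun t =>
    (hφ.continuous.integral_hasStrictDerivAt 0 t).hasDerivAt
  refine ⟨fun u => ∫ s in (0 : ℝ)..u, φ s, by simp, hder, ?_⟩
  have hper : Function.Periodic (fun u => ∫ s in (0 : ℝ)..u, φ s) p := by
    intro u
    have := hφ.periodic.intervalIntegral_add_eq_add 0 u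
      fun t₁ t₂ => hφ.continuous.intervalIntegrable _ _
    simpa [hφ.integral_eq_zero] using this
  have hcont : Continuous (fun u => ∫ s in (0 : ℝ)..u, φ s) :=
    continuous_iff_continuousAt.2 fun t => (hder t).continuousAt
  obtain ⟨C, hC⟩ := (hper.isBounded_of_continuous hp hcont).exists_norm_le
  exact ⟨C, fun t => hC _ ⟨t, rfl⟩⟩

end IsZeroMean

theorem sin_periodic_of_int_mul {p w : ℝ} (hw : ∃ k : ℤ, w * p = k * (2 * Real.pi)) :
    Function.Periodic (fun t => Real.sin (w * t)) p := by
  obtain ⟨k, hk⟩ := hw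
  intro t
  simp only [mul_add, hk, Real.sin_add_int_mul_two_pi]

theorem isZeroMean_sin {p w : ℝ} (hw : ∃ k : ℤ, w * p = k * (2 * Real.pi)) :
    IsZeroMean p (fun t => Real.sin (w * t)) :=
  .of_odd (by fun_prop) (sin_periodic_of_int_mul hw) fun t => by simp

theorem isZeroMean_cos {p w : ℝ} (hw : ∃ k : ℤ, w * p = k * (2 * Real.pi)) (h0 : w ≠ 0) :
    IsZeroMean p (fun t => Real.cos (w * t)) where
  continuous := by fun_prop
  periodic := by
    obtain ⟨k, hk⟩ := hw
    intro t
    simp only [mul_add, hk, Real.cos_add_int_mul_two_pi]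
  integral_eq_zero := by
    obtain ⟨k, hk⟩ := hw
    rw [intervalIntegral.integral_comp_mul_left (fun t => Real.cos t) h0, integral_cos, hk,
      mul_zero, Real.sin_zero]
    have := Real.sin_add_int_mul_two_pi 0 k
    rw [zero_add, Real.sin_zero] at this
    simp [this]

theorem isZeroMean_sin_mul_sin {p v w : ℝ} (hv : ∃ k : ℤ, v * p = k * (2 * Real.pi))
    (hw : ∃ k : ℤ, w * p = k * (2 * Real.pi)) (hsub : v - w ≠ 0) (hadd : v + w ≠ 0) :
    IsZeroMean p (fun t => Real.sin (v * t) * Real.sin (w * t)) := by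
  obtain ⟨k, hk⟩ := hv
  obtain ⟨l, hl⟩ := hw
  have h := ((isZeroMean_cos (p := p) ⟨k - l, by push_cast; linarith⟩ hsub).const_mul (1 / 2)).add
    ((isZeroMean_cos (p := p) ⟨k + l, by push_cast; linarith⟩ hadd).const_mul (-1 / 2))
  convert h using 2 with t
  have := Real.two_mul_sin_mul_sin (v * t) (w * t)
  rw [sub_mul, add_mul]
  linarith

theorem isZeroMean_sin_mul_self {p w : ℝ} (hw : ∃ k : ℤ, w * p = k * (2 * Real.pi))
    (h0 : w ≠ 0) :
    IsZeroMean p (fun t => Real.sin (w * t) * Real.sin (w * t) - 1 / 2) := by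
  obtain ⟨k, hk⟩ := hw
  have h := (isZeroMean_cos (p := p) (w := 2 * w) ⟨2 * k, by push_cast; linarith⟩
    (by simpa using h0)).const_mul (-1 / 2)
  convert h using 2 with t
  rw [mul_assoc, Real.cos_two_mul, Real.cos_sq']
  ring

/-- The product of three sines is odd, hence has zero mean whatever the resonances between the
three frequencies. -/
theorem isZeroMean_sin_mul_sin_mul_sin {p u v w : ℝ} (hu : ∃ k : ℤ, u * p = k * (2 * Real.pi))
    (hv : ∃ k : ℤ, v * p = k * (2 * Real.pi)) (hw : ∃ k : ℤ, w * p = k * (2 * Real.pi)) :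
    IsZeroMean p (fun t => Real.sin (u * t) * Real.sin (v * t) * Real.sin (w * t)) :=
  .of_odd (by fun_prop)
    (((sin_periodic_of_int_mul hu).mul (sin_periodic_of_int_mul hv)).mul
      (sin_periodic_of_int_mul hw))
    fun t => by simp

variable {E F G : Type*} [NormedAddCommGroup E] [NormedSpace ℝ E] [NormedAddCommGroup F]
  [NormedSpace ℝ F] [NormedAddCommGroup G] [NormedSpace ℝ G]

/-- The maps `(τ, x) ↦ g τ x` that are finite sums of products `φ τ • f x`, with `φ` zero-mean
`p`-periodic and `f` continuously differentiable. -/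
inductive IsOscillatory (p : ℝ) : (ℝ → E → F) → Prop
  | zero : IsOscillatory p (fun _ _ => 0)
  | smul {φ : ℝ → ℝ} {f : E → F} (hφ : IsZeroMean p φ) (hf : ContDiff ℝ 1 f) :
      IsOscillatory p (fun τ x => φ τ • f x)
  | add {g₁ g₂ : ℝ → E → F} (h₁ : IsOscillatory p g₁) (h₂ : IsOscillatory p g₂) :
      IsOscillatory p (fun τ x => g₁ τ x + g₂ τ x)

namespace IsOscillatory

variable {p : ℝ} {g : ℝ → E → F}

theorem sum {ι : Type*} (s : Finset ι) {g : ι → ℝ → E → F} (h : ∀ i, IsOscillatory p (g i)) :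
    IsOscillatory p (fun τ x => ∑ i ∈ s, g i τ x) := by
  classical
  induction s using Finset.induction_on with
  | empty => simpa using zero
  | insert i s hi ih => simpa [Finset.sum_insert hi] using (h i).add ih

theorem clm_comp (hg : IsOscillatory p g) (T : F →L[ℝ] G) :
    IsOscillatory p (fun τ x => T (g τ x)) := by
  induction hg with
  | zero => simpa using zero
  | smul hφ hf => simpa using smul hφ (T.contDiff.comp hf)
  | add _ _ ih₁ ih₂ => simpa using ih₁.add ih₂

theorem continuous (hg : IsOscillatory p g) (x : E) : Continuous fun τ => g τ x := by
  induction hg with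
  | zero => exact continuous_const
  | smul hφ hf => exact hφ.continuous.smul continuous_const
  | add _ _ ih₁ ih₂ => exact ih₁.add ih₂

theorem integral_eq_zero [CompleteSpace F] (hg : IsOscillatory p g) (x : E) :
    ∫ τ in (0 : ℝ)..p, g τ x = 0 := by
  induction hg with
  | zero => simp
  | smul hφ hf => rw [intervalIntegral.integral_smul_const, hφ.integral_eq_zero, zero_smul]
  | add h₁ h₂ ih₁ ih₂ =>
    rw [intervalIntegral.integral_add ((h₁.continuous x).intervalIntegrable _ _)
      ((h₂.continuous x).intervalIntegrable _ _), ih₁, ih₂, add_zero]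

/-- An oscillatory map has a primitive in time that is bounded, together with its derivative in
space, uniformly in time. -/
theorem exists_primitive (hp : p ≠ 0) (hg : IsOscillatory p g) :
    ∃ (U : ℝ → E → F) (U' : ℝ → E → E →L[ℝ] F),
      (∀ τ x, HasFDerivAt (fun q : ℝ × E => U q.1 q.2)
        ((ContinuousLinearMap.toSpanSingleton ℝ (g τ x)).coprod (U' τ x)) (τ, x)) ∧
      (∀ x, U 0 x = 0) ∧
      ∀ s : Set E, IsCompact s →
        ∃ C, 0 ≤ C ∧ ∀ τ, ∀ x ∈ s, ‖g τ x‖ ≤ C ∧ ‖U τ x‖ ≤ C ∧ ‖U' τ x‖ ≤ C := by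
  induction hg with
  | zero =>
    refine ⟨fun _ _ => 0, fun _ _ => 0, fun τ x => ?_, fun _ => rfl,
      fun s _ => ⟨0, le_rfl, by simp⟩⟩
    convert hasFDerivAt_const (0 : F) (τ, x)
    ext <;> simp
  | @smul φ f hφ hf =>
    obtain ⟨Φ, hΦ0, hΦ, C₁, hC₁⟩ := hφ.exists_primitive hp
    obtain ⟨C₂, hC₂⟩ := hφ.exists_bound hp
    refine ⟨fun τ x => Φ τ • f x, fun τ x => Φ τ • fderiv ℝ f x, fun τ x => ?_,
      fun x => by simp [hΦ0], fun s hs => ?_⟩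
    · have h1 : HasFDerivAt (fun q : ℝ × E => Φ q.1) _ (τ, x) :=
        (hΦ τ).hasFDerivAt.comp (τ, x) hasFDerivAt_fst
      have h2 : HasFDerivAt (fun q : ℝ × E => f q.2) _ (τ, x) :=
        (hf.differentiable one_ne_zero x).hasFDerivAt.comp (τ, x) hasFDerivAt_snd
      refine (h1.smul h2).congr_fderiv ?_
      ext <;> simp
    · obtain ⟨D₁, hD₁⟩ := hs.exists_bound_of_continuousOn hf.continuous.continuousOn
      obtain ⟨D₂, hD₂⟩ := hs.exists_bound_of_continuousOn
        (hf.continuous_fderiv one_ne_zero).continuousOn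
      have hbd : ∀ {a b x y : ℝ}, 0 ≤ x → 0 ≤ y → x ≤ |a| → y ≤ |b| → x * y ≤ |a| * |b| :=
        fun hx hy h1 h2 => mul_le_mul h1 h2 hy (hx.trans h1)
      refine ⟨|C₂| * |D₁| + |C₁| * |D₁| + |C₁| * |D₂|, by positivity, fun τ x hx => ?_⟩
      have e1 : |φ τ| * ‖f x‖ ≤ |C₂| * |D₁| := hbd (abs_nonneg _) (norm_nonneg _)
        ((hC₂ τ).trans (le_abs_self _)) ((hD₁ x hx).trans (le_abs_self _))
      have e2 : |Φ τ| * ‖f x‖ ≤ |C₁| * |D₁| := hbd (abs_nonneg _) (norm_nonneg _)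
        ((hC₁ τ).trans (le_abs_self _)) ((hD₁ x hx).trans (le_abs_self _))
      have e3 : |Φ τ| * ‖fderiv ℝ f x‖ ≤ |C₁| * |D₂| := hbd (abs_nonneg _) (norm_nonneg _)
        ((hC₁ τ).trans (le_abs_self _)) ((hD₂ x hx).trans (le_abs_self _))
      simp only [norm_smul, Real.norm_eq_abs]
      have p1 : 0 ≤ |C₂| * |D₁| := by positivity
      have p2 : 0 ≤ |C₁| * |D₁| := by positivity
      have p3 : 0 ≤ |C₁| * |D₂| := by positivity
      exact ⟨by linarith, by linarith, by linarith⟩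
  | add _ _ ih₁ ih₂ =>
    obtain ⟨U₁, U₁', hd₁, h0₁, hb₁⟩ := ih₁
    obtain ⟨U₂, U₂', hd₂, h0₂, hb₂⟩ := ih₂
    refine ⟨fun τ x => U₁ τ x + U₂ τ x, fun τ x => U₁' τ x + U₂' τ x, fun τ x => ?_,
      fun x => by simp [h0₁, h0₂], fun s hs => ?_⟩
    · refine ((hd₁ τ x).add (hd₂ τ x)).congr_fderiv ?_
      ext <;> simp
    · obtain ⟨C₁, hC₁, hs₁⟩ := hb₁ s hs
      obtain ⟨C₂, hC₂, hs₂⟩ := hb₂ s hs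
      refine ⟨C₁ + C₂, by positivity, fun τ x hx => ?_⟩
      obtain ⟨a1, a2, a3⟩ := hs₁ τ x hx
      obtain ⟨b1, b2, b3⟩ := hs₂ τ x hx
      exact ⟨norm_add_le_of_le a1 b1, norm_add_le_of_le a2 b2, norm_add_le_of_le a3 b3⟩

end IsOscillatory

theorem exists_lipschitz_bound_of_hasCompactSupport {f : E → F} (hf : ContDiff ℝ 1 f)
    (hs : HasCompactSupport f) : ∃ K L : ℝ≥0, LipschitzWith K f ∧ ∀ x, ‖f x‖ ≤ L := by
  obtain ⟨K, hK⟩ := hf.lipschitzWith_of_hasCompactSupport hs one_ne_zero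
  obtain ⟨L, hL⟩ := hs.exists_bound_of_continuous hf.continuous
  exact ⟨K, L.toNNReal, hK, fun x => (hL x).trans (Real.le_coe_toNNReal L)⟩

theorem IsOscillatory.exists_lipschitz_bound_cutoff {p : ℝ} (hp : p ≠ 0) {g : ℝ → E → F}
    (hg : IsOscillatory p g) {χ : E → ℝ} (hχ : ContDiff ℝ 1 χ) (hs : HasCompactSupport χ) :
    ∃ K L : ℝ≥0, ∀ τ, LipschitzWith K (fun x => χ x • g τ x) ∧ ∀ x, ‖χ x • g τ x‖ ≤ L := by
  induction hg with
  | zero => exact ⟨0, 0, fun τ => by simp [LipschitzWith.const (0 : F)]⟩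
  | @smul φ f hφ hf =>
    obtain ⟨K, L, hK, hL⟩ := exists_lipschitz_bound_of_hasCompactSupport (hχ.smul hf)
      (hs.smul_right (f' := f))
    obtain ⟨C, hC⟩ := hφ.exists_bound hp
    have hC' : ∀ τ, ‖φ τ‖₊ ≤ C.toNNReal := fun τ => by
      rw [← NNReal.coe_le_coe]
      exact (hC τ).trans (Real.le_coe_toNNReal C)
    have hcomm : ∀ τ x, χ x • φ τ • f x = φ τ • (χ x • f x) := fun τ x => smul_comm _ _ _
    refine ⟨C.toNNReal * K, C.toNNReal * L, fun τ => ⟨?_, fun x => ?_⟩⟩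
    · simp only [hcomm]
      refine LipschitzWith.of_dist_le_mul fun x y => ?_
      rw [dist_smul₀, NNReal.coe_mul, mul_assoc]
      exact mul_le_mul (hC' τ) (hK.dist_le_mul x y) dist_nonneg (NNReal.coe_nonneg _)
    · rw [hcomm, norm_smul, NNReal.coe_mul]
      exact mul_le_mul (hC' τ) (hL x) (norm_nonneg _) (NNReal.coe_nonneg _)
  | add _ _ ih₁ ih₂ =>
    obtain ⟨K₁, L₁, h₁⟩ := ih₁
    obtain ⟨K₂, L₂, h₂⟩ := ih₂
    refine ⟨K₁ + K₂, L₁ + L₂, fun τ => ⟨?_, fun x => ?_⟩⟩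
    · simpa only [smul_add] using (h₁ τ).1.add (h₂ τ).1
    · rw [smul_add]
      exact norm_add_le_of_le ((h₁ τ).2 x) ((h₂ τ).2 x)

/-- A smooth cutoff turns the field into a bounded Lipschitz one without changing it on the ball;
this yields, for every initial state, a curve that solves the original equation in the ball. -/
theorem exists_solvesWithin [FiniteDimensional ℝ E] {A : E → E} (hA : ContDiff ℝ 1 A) {p : ℝ}
    (hp : p ≠ 0) {g : ℝ → E → E} (hg : IsOscillatory p g) (xe : E) {r : ℝ} (hr : 0 < r) (ω : ℝ)
    (x₀ : E) :
    ∃ X : ℝ → E, X 0 = x₀ ∧ SolvesWithin (fun t x => A x + g (ω * t) x) (closedBall xe r) X := by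
  have : CompleteSpace E := FiniteDimensional.complete ℝ E
  let χ : ContDiffBump xe := ⟨r, 2 * r, hr, by linarith⟩
  have hχ : ContDiff ℝ 1 χ := χ.contDiff
  obtain ⟨K₁, L₁, hK₁, hL₁⟩ := exists_lipschitz_bound_of_hasCompactSupport (hχ.smul hA)
    (χ.hasCompactSupport.smul_right (f' := A))
  obtain ⟨K₂, L₂, h₂⟩ := hg.exists_lipschitz_bound_cutoff hp hχ χ.hasCompactSupport
  obtain ⟨X, hX0, hX⟩ := exists_hasDerivWithinAt_Ici
    (F := fun t x => χ x • A x + χ x • g (ω * t) x) (K := K₁ + K₂) (L := L₁ + L₂)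
    (fun t => hK₁.add (h₂ (ω * t)).1) (fun t x => norm_add_le_of_le (hL₁ x) ((h₂ (ω * t)).2 x))
    (fun x => continuous_const.add
      (((hg.continuous x).comp (continuous_const.mul continuous_id)).const_smul (χ x))) x₀
  refine ⟨X, hX0, fun t ht => (hX t ht).continuousWithinAt, fun t ht hmem => ?_⟩
  have h := hX t ht
  rwa [χ.one_of_mem_closedBall hmem, one_smul, one_smul] at h

namespace IsContractingAt

variable {A : E → E} {xe : E} {B : E →L[ℝ] E →L[ℝ] ℝ} {r m μ L : ℝ}

theorem exists_solution_expDecay [FiniteDimensional ℝ E] (h : IsContractingAt A xe B r m μ L)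
    (hA : ContDiff ℝ 1 A) :
    ∃ ρ > 0, ∃ κ > 0, ∃ lam > 0, ∀ x₀ : E, ‖x₀ - xe‖ < ρ →
      (∃ X : ℝ → E, X 0 = x₀ ∧ ∀ t, 0 ≤ t → HasDerivWithinAt X (A (X t)) (Ici 0) t) ∧
      ∀ X : ℝ → E, SolvesWithin (fun _ => A) (closedBall xe r) X → X 0 = x₀ → ∀ t, 0 ≤ t →
        ‖X t - xe‖ ≤ r / 2 ∧ ‖X t - xe‖ ≤ κ * ‖x₀ - xe‖ * Real.exp (-(lam * t)) := by
  obtain ⟨ρ, hρ, κ, hκ, lam, hlam, hdec⟩ := h.exists_expDecay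
  refine ⟨ρ, hρ, κ, hκ, lam, hlam, fun x₀ hx₀ => ⟨?_, fun X hX hX0 => ?_⟩⟩
  · obtain ⟨X, hX0, hX⟩ := exists_solvesWithin hA one_ne_zero (IsOscillatory.zero (p := 1)) xe
      h.r_pos 0 x₀
    simp only [add_zero] at hX
    refine ⟨X, hX0, fun t ht => hX.2 t ht ?_⟩
    rw [mem_closedBall, dist_eq_norm]
    linarith [(hdec X hX (by rwa [hX0]) t ht).1, h.r_pos]
  · subst hX0
    exact hdec X hX hx₀

/-- Averaging on the half-line for an oscillatory perturbation of a contracting field. -/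
theorem exists_averaging [FiniteDimensional ℝ E] (h : IsContractingAt A xe B r m μ L)
    (hA : ContDiff ℝ 1 A) {p : ℝ} (hp : p ≠ 0) {g : ℝ → E → E} (hg : IsOscillatory p g) :
    ∃ ρ > 0, ∃ ωs > 0, ∃ C > 0, ∀ x₀ : E, ‖x₀ - xe‖ < ρ → ∀ ω, ωs ≤ ω →
      (∃ X : ℝ → E, X 0 = x₀ ∧
        ∀ t, 0 ≤ t → HasDerivWithinAt X (A (X t) + g (ω * t) (X t)) (Ici 0) t) ∧
      (∃ X : ℝ → E, X 0 = x₀ ∧ ∀ t, 0 ≤ t → HasDerivWithinAt X (A (X t)) (Ici 0) t) ∧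
      ∀ X Xa : ℝ → E,
        (∀ t, 0 ≤ t → HasDerivWithinAt X (A (X t) + g (ω * t) (X t)) (Ici 0) t) → X 0 = x₀ →
        (∀ t, 0 ≤ t → HasDerivWithinAt Xa (A (Xa t)) (Ici 0) t) → Xa 0 = x₀ →
        ∀ t, 0 ≤ t → ‖Xa t - X t‖ ≤ C / ω := by
  have : ProperSpace E := FiniteDimensional.proper ℝ E
  obtain ⟨ρ, hρ, κ, hκ, lam, hlam, hdec⟩ := h.exists_solution_expDecay hA
  obtain ⟨U, U', hU, hU0, hbd⟩ := hg.exists_primitive hp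
  obtain ⟨C₀, hC₀, hb⟩ := hbd (closedBall xe r) (isCompact_closedBall _ _)
  obtain ⟨ωs, hωs, C, hC, hest⟩ := h.exists_averaging_bound hC₀ hU hU0 hb
  refine ⟨ρ, hρ, ωs, hωs, C, hC, fun x₀ hx₀ ω hω => ?_⟩
  obtain ⟨⟨Xa, hXa0, hXa⟩, hall⟩ := hdec x₀ hx₀
  refine ⟨?_, ⟨Xa, hXa0, hXa⟩, fun X Xa hX hX0 hXa hXa0 t ht => ?_⟩
  · obtain ⟨X, hX0, hX⟩ := exists_solvesWithin hA hp hg xe h.r_pos ω x₀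
    refine ⟨X, hX0, fun t ht => hX.2 t ht ?_⟩
    have hXa' : SolvesWithin (fun _ => A) (closedBall xe r) Xa := .of_forall hXa _
    rw [mem_closedBall, dist_eq_norm]
    exact (hest ω hω X Xa hX hXa' (hX0.trans hXa0.symm)
      (fun s hs => (hall Xa hXa' hXa0 s hs).1) t ht).1
  · have hXa' : SolvesWithin (fun _ => A) (closedBall xe r) Xa := .of_forall hXa _
    exact (hest ω hω X Xa (.of_forall (F := fun t x => A x + g (ω * t) x) hX _) hXa'
      (hX0.trans hXa0.symm) (fun s hs => (hall Xa hXa' hXa0 s hs).1) t ht).2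

end IsContractingAt

/-! ### Lyapunov forms for linear cascades -/

section Cascade

variable {E F G : Type*} [NormedAddCommGroup E] [NormedSpace ℝ E]
  [NormedAddCommGroup F] [NormedAddCommGroup G] [NormedSpace ℝ G]

/-- A linear map that vanishes on the kernel of `W` is dominated by `W`. -/
theorem exists_norm_le_mul_norm_of_ker [FiniteDimensional ℝ E] [NormedSpace ℝ F]
    (T : E →L[ℝ] F) (W : E →L[ℝ] G) (h : ∀ x, W x = 0 → T x = 0) :
    ∃ C, 0 ≤ C ∧ ∀ x, ‖T x‖ ≤ C * ‖W x‖ := by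
  obtain ⟨s, hs⟩ := W.toLinearMap.rangeRestrict.exists_rightInverse_of_surjective
    W.toLinearMap.range_rangeRestrict
  set T' := (T.toLinearMap ∘ₗ s).toContinuousLinearMap with hT'
  refine ⟨‖T'‖, T'.opNorm_nonneg, fun x => ?_⟩
  have h1 : W (s (W.toLinearMap.rangeRestrict x)) = W x := by
    have := congrArg Subtype.val (LinearMap.congr_fun hs (W.toLinearMap.rangeRestrict x))
    simpa using this
  have h2 : T x = T' (W.toLinearMap.rangeRestrict x) := by
    have := h (x - s (W.toLinearMap.rangeRestrict x)) (by rw [map_sub, h1, sub_self])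
    rw [map_sub, sub_eq_zero] at this
    simpa [hT'] using this
  rw [h2]
  exact T'.le_opNorm _

/-- The linear system `dx/dt = L x` has a quadratic Lyapunov function that controls `P x` and
dissipates it. For injective `P` this is Lyapunov's condition for exponential stability; the other
instances describe the driving subsystems of a cascade. -/
def DecaysAlong [NormedSpace ℝ F] (L : E →L[ℝ] E) (P : E →L[ℝ] F) : Prop :=
  ∃ B : E →L[ℝ] E →L[ℝ] ℝ, (∀ x y, B x y = B y x) ∧ ∃ m > 0,
    (∀ x, m * ‖P x‖ ^ 2 ≤ B x x) ∧ ∀ x, B x (L x) ≤ -m * ‖P x‖ ^ 2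

theorem decaysAlong_zero [NormedSpace ℝ F] (L : E →L[ℝ] E) : DecaysAlong L (0 : E →L[ℝ] F) :=
  ⟨0, by simp, 1, one_pos, by simp, by simp⟩

/-- A subsystem `P` that is dissipative up to an input from `W` may be added to `W`: a large
multiple of the Lyapunov function of `W` absorbs the input. -/
theorem DecaysAlong.prod [NormedSpace ℝ F] {L : E →L[ℝ] E} {W : E →L[ℝ] G} (hW : DecaysAlong L W)
    {P : E →L[ℝ] F} {B : E →L[ℝ] E →L[ℝ] ℝ} (hsymm : ∀ x y, B x y = B y x) {m C : ℝ} (hm : 0 < m)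
    (hco : ∀ x, m * ‖P x‖ ^ 2 ≤ B x x)
    (hL : ∀ x, B x (L x) ≤ -m * ‖P x‖ ^ 2 + C * ‖W x‖ ^ 2) : DecaysAlong L (P.prod W) := by
  obtain ⟨B₂, hsymm₂, m₂, hm₂, hco₂, hL₂⟩ := hW
  set s : ℝ := (|C| + m) / m₂ with hs
  have hsm : s * m₂ = |C| + m := by rw [hs]; field_simp
  have hspos : 0 < s := by positivity
  have hnorm : ∀ x, ‖P.prod W x‖ ^ 2 ≤ ‖P x‖ ^ 2 + ‖W x‖ ^ 2 := by
    intro x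
    rw [ContinuousLinearMap.prod_apply, Prod.norm_def]
    rcases max_cases ‖P x‖ ‖W x‖ with h | h <;> rw [h.1] <;>
      nlinarith [sq_nonneg ‖P x‖, sq_nonneg ‖W x‖]
  have hW2 : ∀ x, s * (m₂ * ‖W x‖ ^ 2) = (|C| + m) * ‖W x‖ ^ 2 := fun x => by rw [← hsm]; ring
  refine ⟨B + s • B₂, fun x y => ?_, m, hm, fun x => ?_, fun x => ?_⟩
  · simp [hsymm x y, hsymm₂ x y]
  · have h1 := mul_le_mul_of_nonneg_left (hnorm x) hm.le
    have h2 := mul_le_mul_of_nonneg_left (hco₂ x) hspos.le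
    have h3 : 0 ≤ |C| * ‖W x‖ ^ 2 := by positivity
    simp only [add_apply, smul_apply, smul_eq_mul]
    linarith [hco x, hW2 x]
  · have h1 := mul_le_mul_of_nonneg_left (hnorm x) hm.le
    have h2 := mul_le_mul_of_nonneg_left (hL₂ x) hspos.le
    have h3 : C * ‖W x‖ ^ 2 ≤ |C| * ‖W x‖ ^ 2 := by gcongr; exact le_abs_self C
    simp only [add_apply, smul_apply, smul_eq_mul]
    linarith [hL x, hW2 x]

theorem DecaysAlong.exists_lyapunov [FiniteDimensional ℝ E] [NormedSpace ℝ F]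
    {L : E →L[ℝ] E} {P : E →L[ℝ] F} (h : DecaysAlong L P) (hP : ∀ x, P x = 0 → x = 0) :
    ∃ B : E →L[ℝ] E →L[ℝ] ℝ, (∀ x y, B x y = B y x) ∧ ∃ m > 0,
      (∀ x, m * ‖x‖ ^ 2 ≤ B x x) ∧ ∀ x, B x (L x) ≤ -m * ‖x‖ ^ 2 := by
  obtain ⟨B, hsymm, m, hm, hco, hL⟩ := h
  obtain ⟨C, hC, hle⟩ := exists_norm_le_mul_norm_of_ker (.id ℝ E) P hP
  have key : ∀ x, m / (C ^ 2 + 1) * ‖x‖ ^ 2 ≤ m * ‖P x‖ ^ 2 := by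
    intro x
    rw [div_mul_eq_mul_div, div_le_iff₀ (by positivity), mul_assoc]
    have h1 : ‖x‖ ^ 2 ≤ (C * ‖P x‖) ^ 2 := by gcongr; exact hle x
    have h2 : 0 ≤ ‖P x‖ ^ 2 := by positivity
    gcongr
    linarith
  exact ⟨B, hsymm, m / (C ^ 2 + 1), by positivity, fun x => (key x).trans (hco x),
    fun x => (hL x).trans (by linarith [key x])⟩

variable [InnerProductSpace ℝ F]

/-- A first-order filter `d(P x)/dt = -ω P x` driven by `W` extends the cascade; `h` is the equation
of the filter with the input switched off. -/
theorem DecaysAlong.filter [FiniteDimensional ℝ E] {L : E →L[ℝ] E} {W : E →L[ℝ] G}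
    (hW : DecaysAlong L W)
    {P : E →L[ℝ] F} {ω : ℝ} (hω : 0 < ω) (h : ∀ x, W x = 0 → P (L x) = -(ω • P x)) :
    DecaysAlong L (P.prod W) := by
  obtain ⟨C, hC, hle⟩ := exists_norm_le_mul_norm_of_ker (P ∘L L + ω • P) W
    fun x hx => by simp [h x hx]
  refine hW.prod (B := (innerSL ℝ).bilinearComp P P) (m := min 1 (ω / 2)) (C := C ^ 2 / (2 * ω))
    (fun x y => ?_) (by positivity) (fun x => ?_) (fun x => ?_)
  · simp [real_inner_comm]
  · simp only [ContinuousLinearMap.bilinearComp_apply, innerSL_apply_apply,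
      real_inner_self_eq_norm_sq]
    nlinarith [min_le_left 1 (ω / 2), sq_nonneg ‖P x‖]
  · have h1 : P (L x) = (P ∘L L + ω • P) x - ω • P x := by simp
    simp only [ContinuousLinearMap.bilinearComp_apply, innerSL_apply_apply]
    rw [h1, inner_sub_right, real_inner_smul_right, real_inner_self_eq_norm_sq]
    have h2 := (real_inner_le_norm (P x) ((P ∘L L + ω • P) x)).trans
      (mul_le_mul_of_nonneg_left (hle x) (norm_nonneg _))
    have h3 : ‖P x‖ * (C * ‖W x‖) ≤ ω / 2 * ‖P x‖ ^ 2 + C ^ 2 / (2 * ω) * ‖W x‖ ^ 2 := by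
      have : ω / 2 * ‖P x‖ ^ 2 + C ^ 2 / (2 * ω) * ‖W x‖ ^ 2 - ‖P x‖ * (C * ‖W x‖)
          = (ω * ‖P x‖ - C * ‖W x‖) ^ 2 / (2 * ω) := by field_simp; ring
      have : 0 ≤ (ω * ‖P x‖ - C * ‖W x‖) ^ 2 / (2 * ω) := by positivity
      linarith
    have h4 : min 1 (ω / 2) * ‖P x‖ ^ 2 ≤ ω / 2 * ‖P x‖ ^ 2 := by
      gcongr; exact min_le_right _ _
    linarith

/-- The second-order system `dZ/dt = ω V`, `S dV/dt = -T Z - ω S V` with positive definite `S` and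
`T`. The energy `⟪Z, T Z⟫ + ω ⟪V, S V⟫` dissipates only `V`; the cross term `2 ε ⟪V, S Z⟫` with a
small `ε` makes it dissipate `Z` as well. The equations `hZ` and `hV` need hold only with the input
from `W` switched off. -/
theorem DecaysAlong.secondOrder [FiniteDimensional ℝ E] {L : E →L[ℝ] E} {W : E →L[ℝ] G}
    (hW : DecaysAlong L W)
    {Z V : E →L[ℝ] F} {S T : F →L[ℝ] F} {ω s b : ℝ} (hω : 0 < ω) (hs : 0 < s) (hb : 0 < b)
    (hSsymm : ∀ u v, ⟪u, S v⟫ = ⟪v, S u⟫) (hTsymm : ∀ u v, ⟪u, T v⟫ = ⟪v, T u⟫)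
    (hS : ∀ u, s * ‖u‖ ^ 2 ≤ ⟪u, S u⟫) (hT : ∀ u, b * ‖u‖ ^ 2 ≤ ⟪u, T u⟫)
    (hZ : ∀ x, W x = 0 → Z (L x) = ω • V x)
    (hV : ∀ x, W x = 0 → S (V (L x)) = -(T (Z x)) - ω • S (V x)) :
    DecaysAlong L ((Z.prod V).prod W) := by
  obtain ⟨C₁, hC₁, hle₁⟩ := exists_norm_le_mul_norm_of_ker (Z ∘L L - ω • V) W
    fun x hx => by simp [hZ x hx]
  obtain ⟨C₂, hC₂, hle₂⟩ := exists_norm_le_mul_norm_of_ker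
    (S ∘L V ∘L L + T ∘L Z + ω • (S ∘L V)) W fun x hx => by simp [hV x hx]; abel
  obtain ⟨ε, hε, hεω, hεσ⟩ : ∃ ε > 0, ε ≤ ω / 2 ∧ ε * ‖S‖ ^ 2 ≤ b * s / 2 := by
    refine ⟨min (ω / 2) (b * s / (2 * (‖S‖ ^ 2 + 1))), by positivity, min_le_left _ _, ?_⟩
    calc _ ≤ b * s / (2 * (‖S‖ ^ 2 + 1)) * (‖S‖ ^ 2 + 1) := by
          gcongr
          · exact min_le_right _ _
          · linarith
      _ = _ := by field_simp
  set K : ℝ := ‖T‖ * C₁ + ω * C₂ + ε * ‖S‖ * C₁ + ε * C₂ with hK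
  set m₀ : ℝ := min (ω ^ 2 * s / 4) (ε * b / 2) with hm₀
  have hm₀pos : 0 < m₀ := by positivity
  set m : ℝ := min (m₀ / 2) (min (b / 2) (ω * s / 2)) with hm
  have hmpos : 0 < m := by positivity
  have hm1 : m ≤ m₀ / 2 := min_le_left _ _
  have hm2 : m ≤ b / 2 := (min_le_right _ _).trans (min_le_left _ _)
  have hm3 : m ≤ ω * s / 2 := (min_le_right _ _).trans (min_le_right _ _)
  have hnorm : ∀ x, ‖Z.prod V x‖ ^ 2 ≤ ‖Z x‖ ^ 2 + ‖V x‖ ^ 2 := by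
    intro x
    rw [ContinuousLinearMap.prod_apply, Prod.norm_def]
    rcases max_cases ‖Z x‖ ‖V x‖ with h | h <;> rw [h.1] <;>
      linarith [sq_nonneg ‖Z x‖, sq_nonneg ‖V x‖]
  have hcs : ∀ (R : F →L[ℝ] F) (u v : F), |⟪u, R v⟫| ≤ ‖R‖ * ‖u‖ * ‖v‖ := fun R u v => by
    refine (abs_real_inner_le_norm _ _).trans ?_
    rw [mul_comm ‖R‖, mul_assoc]
    gcongr
    exact R.le_opNorm v
  obtain ⟨I, hI⟩ : ∃ I : F →L[ℝ] F →L[ℝ] ℝ, ∀ u v, I u v = ⟪u, v⟫ :=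
    ⟨innerSL ℝ, fun _ _ => rfl⟩
  refine hW.prod (B := I.bilinearComp Z (T ∘L Z) + ω • I.bilinearComp V (S ∘L V)
    + ε • (I.bilinearComp V (S ∘L Z) + I.bilinearComp Z (S ∘L V))) (m := m) (C := K ^ 2 / m₀)
    (fun x y => ?_) hmpos (fun x => ?_) (fun x => ?_)
  · simp only [add_apply, smul_apply, ContinuousLinearMap.bilinearComp_apply, hI,
      ContinuousLinearMap.comp_apply, smul_eq_mul]
    rw [hTsymm (Z x), hSsymm (V x) (V y), hSsymm (V x) (Z y), hSsymm (Z x) (V y)]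
    ring
  · simp only [add_apply, smul_apply, ContinuousLinearMap.bilinearComp_apply, hI,
      ContinuousLinearMap.comp_apply, smul_eq_mul]
    rw [hSsymm (Z x) (V x)]
    have h1 := neg_le_of_abs_le (hcs S (V x) (Z x))
    have h2 := hT (Z x)
    have h3 := hS (V x)
    have h4 := mul_le_mul_of_nonneg_left h1 (by positivity : 0 ≤ 2 * ε)
    have h5 := mul_le_mul_of_nonneg_left h3 hω.le
    have h6 : 2 * ε * (‖S‖ * ‖V x‖ * ‖Z x‖) ≤ b / 2 * ‖Z x‖ ^ 2 + ω * s / 2 * ‖V x‖ ^ 2 := by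
      have e1 : 2 * ε * (‖S‖ * ‖V x‖ * ‖Z x‖)
          ≤ b / 2 * ‖Z x‖ ^ 2 + 2 * ε * (ε * ‖S‖ ^ 2) / b * ‖V x‖ ^ 2 := by
        have : b / 2 * ‖Z x‖ ^ 2 + 2 * ε * (ε * ‖S‖ ^ 2) / b * ‖V x‖ ^ 2
            - 2 * ε * (‖S‖ * ‖V x‖ * ‖Z x‖) = (b * ‖Z x‖ - 2 * ε * ‖S‖ * ‖V x‖) ^ 2 / (2 * b) := by
          field_simp; ring
        have : 0 ≤ (b * ‖Z x‖ - 2 * ε * ‖S‖ * ‖V x‖) ^ 2 / (2 * b) := by positivity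
        linarith
      have e2 : 2 * ε * (ε * ‖S‖ ^ 2) / b ≤ ω * s / 2 := by
        calc _ ≤ 2 * (ω / 2) * (b * s / 2) / b := by gcongr
          _ = _ := by field_simp
      have e3 := mul_le_mul_of_nonneg_right e2 (sq_nonneg ‖V x‖)
      linarith
    have h7 := mul_le_mul_of_nonneg_left (hnorm x) hmpos.le
    have h8 := mul_le_mul_of_nonneg_right hm2 (sq_nonneg ‖Z x‖)
    have h9 := mul_le_mul_of_nonneg_right hm3 (sq_nonneg ‖V x‖)
    linarith
  · set z := Z x
    set v := V x
    set w := ‖W x‖ with hw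
    obtain ⟨n₁, hn₁, hn₁w⟩ : ∃ n₁, Z (L x) = ω • v + n₁ ∧ ‖n₁‖ ≤ C₁ * w :=
      ⟨Z (L x) - ω • v, by abel, hle₁ x⟩
    obtain ⟨n₂, hn₂, hn₂w⟩ : ∃ n₂, S (V (L x)) = n₂ - T z - ω • S v ∧ ‖n₂‖ ≤ C₂ * w :=
      ⟨S (V (L x)) + T z + ω • S v, by abel, hle₂ x⟩
    simp only [add_apply, smul_apply, ContinuousLinearMap.bilinearComp_apply, hI,
      ContinuousLinearMap.comp_apply, smul_eq_mul]
    have hw0 : 0 ≤ w := norm_nonneg _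
    rw [hn₁, hn₂]
    simp only [map_add, map_smul, inner_add_right, inner_sub_right, real_inner_smul_right]
    rw [hTsymm v z]
    have a1 : ⟪z, T n₁⟫ ≤ ‖T‖ * ‖z‖ * (C₁ * w) :=
      (le_abs_self _).trans ((hcs T z n₁).trans (by gcongr))
    have a2 : ⟪v, S n₁⟫ ≤ ‖S‖ * ‖v‖ * (C₁ * w) :=
      (le_abs_self _).trans ((hcs S v n₁).trans (by gcongr))
    have a3 : ⟪v, n₂⟫ ≤ ‖v‖ * (C₂ * w) := (real_inner_le_norm _ _).trans (by gcongr)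
    have a4 : ⟪z, n₂⟫ ≤ ‖z‖ * (C₂ * w) := (real_inner_le_norm _ _).trans (by gcongr)
    have a5 : -⟪z, S v⟫ ≤ ‖S‖ * ‖z‖ * ‖v‖ := (neg_le_abs _).trans (hcs S z v)
    have b2 := mul_le_mul_of_nonneg_left a2 hε.le
    have b3 := mul_le_mul_of_nonneg_left a3 hω.le
    have b4 := mul_le_mul_of_nonneg_left a4 hε.le
    have b5 := mul_le_mul_of_nonneg_left a5 (by positivity : 0 ≤ ε * ω)
    have b6 := mul_le_mul_of_nonneg_left (hT z) hε.le
    have b7 : ω ^ 2 / 2 * (s * ‖v‖ ^ 2) ≤ (ω ^ 2 - ε * ω) * ⟪v, S v⟫ := by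
      have e1 : ω ^ 2 / 2 ≤ ω ^ 2 - ε * ω := by nlinarith
      exact mul_le_mul e1 (hS v) (by positivity) (le_trans (by positivity) e1)
    have c1 : ε * ω * (‖S‖ * ‖z‖ * ‖v‖) ≤ ε * b / 2 * ‖z‖ ^ 2 + ω ^ 2 * s / 4 * ‖v‖ ^ 2 := by
      have e1 : ε * ω * (‖S‖ * ‖z‖ * ‖v‖)
          ≤ ε * b / 2 * ‖z‖ ^ 2 + ω ^ 2 * (ε * ‖S‖ ^ 2) / (2 * b) * ‖v‖ ^ 2 := by
        have : ε * b / 2 * ‖z‖ ^ 2 + ω ^ 2 * (ε * ‖S‖ ^ 2) / (2 * b) * ‖v‖ ^ 2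
            - ε * ω * (‖S‖ * ‖z‖ * ‖v‖) = ε * (b * ‖z‖ - ω * ‖S‖ * ‖v‖) ^ 2 / (2 * b) := by
          field_simp; ring
        have : 0 ≤ ε * (b * ‖z‖ - ω * ‖S‖ * ‖v‖) ^ 2 / (2 * b) := by positivity
        linarith
      have e2 : ω ^ 2 * (ε * ‖S‖ ^ 2) / (2 * b) ≤ ω ^ 2 * s / 4 := by
        calc _ ≤ ω ^ 2 * (b * s / 2) / (2 * b) := by gcongr
          _ = _ := by field_simp; ring
      have e3 := mul_le_mul_of_nonneg_right e2 (sq_nonneg ‖v‖)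
      linarith
    have c2 : m₀ * ‖z‖ ^ 2 ≤ ε * b / 2 * ‖z‖ ^ 2 := by gcongr; exact min_le_right _ _
    have c3 : m₀ * ‖v‖ ^ 2 ≤ ω ^ 2 * s / 4 * ‖v‖ ^ 2 := by gcongr; exact min_le_left _ _
    have hyoung : ∀ y : ℝ, K * y * w ≤ m₀ / 2 * y ^ 2 + K ^ 2 / (2 * m₀) * w ^ 2 := by
      intro y
      have : m₀ / 2 * y ^ 2 + K ^ 2 / (2 * m₀) * w ^ 2 - K * y * w
          = (m₀ * y - K * w) ^ 2 / (2 * m₀) := by field_simp; ring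
      have : 0 ≤ (m₀ * y - K * w) ^ 2 / (2 * m₀) := by positivity
      linarith
    have c4 : ‖T‖ * ‖z‖ * (C₁ * w) + ε * (‖S‖ * ‖v‖ * (C₁ * w)) + ω * (‖v‖ * (C₂ * w))
        + ε * (‖z‖ * (C₂ * w)) ≤ K * ‖z‖ * w + K * ‖v‖ * w := by
      have e1 : 0 ≤ (ω * C₂ + ε * ‖S‖ * C₁) * ‖z‖ * w := by positivity
      have e2 : 0 ≤ (‖T‖ * C₁ + ε * C₂) * ‖v‖ * w := by positivity
      rw [hK]
      linarith
    have c5 : K ^ 2 / m₀ * w ^ 2 = 2 * (K ^ 2 / (2 * m₀) * w ^ 2) := by field_simp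
    have d1 := mul_le_mul_of_nonneg_left (hnorm x) hmpos.le
    have d2 := mul_le_mul_of_nonneg_right hm1 (by positivity : 0 ≤ ‖z‖ ^ 2 + ‖v‖ ^ 2)
    have d3 : m * (‖Z x‖ ^ 2 + ‖V x‖ ^ 2) = m * (‖z‖ ^ 2 + ‖v‖ ^ 2) := rfl
    linarith [hyoung ‖z‖, hyoung ‖v‖]

end Cascade

/-! ### The equilibrium of the averaged system and its linearization -/

section Smooth

theorem sqrt_pos_of_smoothing {δ : ℝ} (hδ : 0 < δ) (x : ℝ) : 0 < Real.sqrt (x ^ 2 + δ) :=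
  Real.sqrt_pos.2 (by positivity)

theorem hasDerivAt_smoothMax {δ : ℝ} (hδ : 0 < δ) (x : ℝ) :
    HasDerivAt (smoothMax δ) ((1 + x / Real.sqrt (x ^ 2 + δ)) / 2) x := by
  have h1 : HasDerivAt (fun y : ℝ => y ^ 2 + δ) (2 * x) x := by
    simpa using (hasDerivAt_pow 2 x).add_const δ
  have h2 := ((hasDerivAt_id x).add (h1.sqrt (by positivity))).div_const 2
  refine h2.congr_deriv ?_
  have := sqrt_pos_of_smoothing hδ x
  field_simp

theorem smoothMax_slope_mem_Ioo {δ : ℝ} (hδ : 0 < δ) (x : ℝ) :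
    (1 + x / Real.sqrt (x ^ 2 + δ)) / 2 ∈ Ioo (0 : ℝ) 1 := by
  have hpos := sqrt_pos_of_smoothing hδ x
  have habs : |x| < Real.sqrt (x ^ 2 + δ) := by
    rw [← Real.sqrt_sq_eq_abs]
    exact Real.sqrt_lt_sqrt (sq_nonneg x) (by linarith)
  have h := abs_lt.1 habs
  have h1 : -1 < x / Real.sqrt (x ^ 2 + δ) := by rw [lt_div_iff₀ hpos]; linarith [h.1]
  have h2 : x / Real.sqrt (x ^ 2 + δ) < 1 := by rw [div_lt_one hpos]; exact h.2
  constructor <;> linarith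

theorem contDiff_smoothMax {δ : ℝ} (hδ : 0 < δ) : ContDiff ℝ 1 (smoothMax δ) := by
  unfold smoothMax
  exact (contDiff_id.add (((contDiff_id.pow 2).add contDiff_const).sqrt
    fun x => by simp only [id]; positivity)).div_const 2

end Smooth

section Matrix

variable {n : ℕ} {H : Matrix (Fin n) (Fin n) ℝ}

theorem inner_toEuclideanLin_comm (hH : H.PosDef) (u v : Vec n) :
    ⟪u, H.toEuclideanLin v⟫ = ⟪v, H.toEuclideanLin u⟫ := by
  have := (Matrix.isPositive_toEuclideanLin_iff.2 hH.posSemidef).isSymmetric v u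
  rw [← this, real_inner_comm]

theorem inner_toEuclideanLin_pos (hH : H.PosDef) {u : Vec n} (hu : u ≠ 0) :
    0 < ⟪u, H.toEuclideanLin u⟫ := by
  have h := hH.dotProduct_mulVec_pos (x := u.ofLp) (by simpa using hu)
  rw [star_trivial, dotProduct_comm] at h
  rwa [EuclideanSpace.inner_eq_star_dotProduct, Matrix.ofLp_toLpLin, Matrix.toLin'_apply,
    star_trivial]

theorem toEuclideanLin_mul_inv (hH : H.PosDef) (u : Vec n) :
    H.toEuclideanLin (H⁻¹.toEuclideanLin u) = u := by
  have := LinearMap.congr_fun (Matrix.toLpLin_mul_same 2 H H⁻¹) u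
  rw [Matrix.mul_nonsing_inv _ ((Matrix.isUnit_iff_isUnit_det _).1 hH.isUnit)] at this
  simpa using this.symm

theorem toEuclideanLin_inv_mul (hH : H.PosDef) (u : Vec n) :
    H⁻¹.toEuclideanLin (H.toEuclideanLin u) = u := by
  have := LinearMap.congr_fun (Matrix.toLpLin_mul_same 2 H⁻¹ H) u
  rw [Matrix.nonsing_inv_mul _ ((Matrix.isUnit_iff_isUnit_det _).1 hH.isUnit)] at this
  simpa using this.symm

theorem exists_coercive {F : Type*} [NormedAddCommGroup F] [InnerProductSpace ℝ F]
    [FiniteDimensional ℝ F] (T : F →L[ℝ] F) (h : ∀ u, u ≠ 0 → 0 < ⟪u, T u⟫) :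
    ∃ b > 0, ∀ u, b * ‖u‖ ^ 2 ≤ ⟪u, T u⟫ := by
  have : ProperSpace F := FiniteDimensional.proper ℝ F
  rcases (sphere (0 : F) 1).eq_empty_or_nonempty with he | hne
  · refine ⟨1, one_pos, fun u => ?_⟩
    have : u = 0 := by
      by_contra hu
      have : ‖u‖⁻¹ • u ∈ sphere (0 : F) 1 := by
        rw [mem_sphere_zero_iff_norm, norm_smul, norm_inv, norm_norm,
          inv_mul_cancel₀ (norm_ne_zero_iff.2 hu)]
      rw [he] at this
      exact this
    simp [this]
  · obtain ⟨u₀, hu₀, hmin⟩ := (isCompact_sphere (0 : F) 1).exists_isMinOn hne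
      (f := fun u => ⟪u, T u⟫) (by fun_prop)
    rw [mem_sphere_zero_iff_norm] at hu₀
    refine ⟨⟪u₀, T u₀⟫, h u₀ (by rw [← norm_ne_zero_iff, hu₀]; exact one_ne_zero), fun u => ?_⟩
    rcases eq_or_ne u 0 with rfl | hu
    · simp
    have hn : 0 < ‖u‖ := norm_pos_iff.2 hu
    have h1 : ⟪u₀, T u₀⟫ ≤ ⟪‖u‖⁻¹ • u, T (‖u‖⁻¹ • u)⟫ := hmin (by
      rw [mem_sphere_zero_iff_norm, norm_smul, norm_inv, norm_norm, inv_mul_cancel₀ hn.ne'])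
    rw [map_smul, real_inner_smul_left, real_inner_smul_right] at h1
    calc _ ≤ ‖u‖⁻¹ * (‖u‖⁻¹ * ⟪u, T u⟫) * ‖u‖ ^ 2 := by gcongr
      _ = _ := by field_simp

end Matrix

namespace Data

variable {n : ℕ} {P : Data n}

theorem q_pos (hH : P.H.PosDef) (hh₁ : P.h₁ ≠ 0) : 0 < P.q := by
  have hne : P.H⁻¹.toEuclideanLin P.h₁ ≠ 0 := fun h => hh₁ (by
    have := toEuclideanLin_mul_inv hH P.h₁
    rwa [h, map_zero, eq_comm] at this)
  have := inner_toEuclideanLin_pos hH hne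
  rwa [toEuclideanLin_mul_inv hH, real_inner_comm] at this

theorem J_param_add (x : Vec n) :
    P.J (x + P.θstar) = P.Jstar + 1 / 2 * ⟪x, P.H.toEuclideanLin x⟫ := by
  simp [J]

theorem h_param_add (x : Vec n) : P.h (x + P.θstar) = P.h₀ + ⟪P.h₁, x⟫ := by
  simp [h]

/-- The argument of the smooth maximum at the equilibrium. -/
noncomputable def eqArg (P : Data n) : ℝ := P.k * ⟪P.eqGradJ, P.h₁⟫ - P.c * ((P.h₀ + P.root) / 2)

/-- The equilibrium condition for `θ`. With `M` the right-hand side it reads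
`√(eqArg ^ 2 + δ) = 2 M - eqArg`, and squaring gives the quadratic equation solved by `root`. -/
theorem smoothMax_eqArg (hH : P.H.PosDef) (hh₁ : P.h₁ ≠ 0) (hk : 0 < P.k) (hc : 0 < P.c)
    (hδ : 0 < P.δ) : smoothMax P.δ P.eqArg = P.k * ⟪P.eqGradJ, P.h₁⟫ := by
  have hq := q_pos hH hh₁
  have hn : 0 < ‖P.h₁‖ := norm_pos_iff.2 hh₁
  have hd : 0 < P.δ * P.d / P.c ^ 2 := by unfold d; positivity
  have hR : P.root ^ 2 = P.h₀ ^ 2 + P.δ * P.d / P.c ^ 2 := Real.sq_sqrt (by positivity)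
  have habs : |P.h₀| < P.root := by
    rw [← Real.sqrt_sq_eq_abs]
    exact Real.sqrt_lt_sqrt (sq_nonneg _) (by linarith)
  have h1 := (abs_lt.1 habs).1
  have h2 := (abs_lt.1 habs).2
  have hM : P.k * ⟪P.eqGradJ, P.h₁⟫ = P.k * ((P.root - P.h₀) / (2 * P.q) * ‖P.h₁‖ ^ 2) := by
    rw [eqGradJ, real_inner_smul_left, real_inner_self_eq_norm_sq]
    ring
  set M := P.k * ⟪P.eqGradJ, P.h₁⟫ with hMdef
  have hMpos : 0 < M := by
    rw [hM]
    have : 0 < P.root - P.h₀ := by linarith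
    positivity
  have hs : P.eqArg = M - P.c * ((P.h₀ + P.root) / 2) := rfl
  have hprod : P.c * (P.h₀ + P.root) * (2 * M) = P.δ := by
    have : P.c * (P.h₀ + P.root) * (2 * M)
        = P.c * P.k * ‖P.h₁‖ ^ 2 / P.q * (P.root ^ 2 - P.h₀ ^ 2) := by
      rw [hM]; field_simp; ring
    rw [this, hR, d]
    field_simp
    ring
  have hsqrt : Real.sqrt (P.eqArg ^ 2 + P.δ) = 2 * M - P.eqArg := by
    rw [show P.eqArg ^ 2 + P.δ = (2 * M - P.eqArg) ^ 2 by rw [← hprod, hs]; ring]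
    refine Real.sqrt_sq ?_
    rw [hs]
    have : 0 < P.c * (P.h₀ + P.root) := mul_pos hc (by linarith)
    linarith
  rw [smoothMax, hsqrt]
  ring

theorem avgFieldClosed_equilibrium (hH : P.H.PosDef) (hh₁ : P.h₁ ≠ 0) (hk : 0 < P.k)
    (hc : 0 < P.c) (hδ : 0 < P.δ) (a : ℝ) : P.avgFieldClosed a (P.equilibrium a) = 0 := by
  have hq := q_pos hH hh₁
  have hn : 0 < ‖P.h₁‖ := norm_pos_iff.2 hh₁
  have hmax := smoothMax_eqArg hH hh₁ hk hc hδ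
  have hinv : P.H⁻¹.toEuclideanLin P.eqGradJ
      = ((-P.h₀ + P.root) / (2 * P.q)) • P.H⁻¹.toEuclideanLin P.h₁ := by
    rw [eqGradJ, map_smul]
  have e1 : -(P.k • P.eqGradJ)
      + (1 / ‖P.h₁‖ ^ 2 * smoothMax P.δ P.eqArg) • P.h₁ = 0 := by
    rw [hmax, eqGradJ, real_inner_smul_left, real_inner_self_eq_norm_sq, smul_smul, ← neg_smul,
      ← add_smul]
    convert zero_smul ℝ P.h₁
    field_simp
    ring
  have e3 : ⟪P.H⁻¹.toEuclideanLin P.eqGradJ, P.eqGradJ⟫ = (-P.h₀ + P.root) ^ 2 / (4 * P.q) := by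
    rw [hinv, real_inner_smul_left, real_inner_comm, eqGradJ, real_inner_smul_left]
    change _ * (_ * P.q) = _
    field_simp
    ring
  have e5 : ⟪P.h₁, P.H⁻¹.toEuclideanLin P.eqGradJ⟫ = (-P.h₀ + P.root) / 2 := by
    rw [hinv, real_inner_smul_right]
    change _ * P.q = _
    field_simp
  simp only [avgFieldClosed, equilibrium, State.param, State.gradJ, State.etaJ, State.gradh,
    State.etah, State.gamma, J_param_add, h_param_add, toEuclideanLin_mul_inv hH]
  refine Prod.ext e1 (Prod.ext ?_ (Prod.ext ?_ (Prod.ext ?_ (Prod.ext ?_ ?_))))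
  · simp
  · simp only [e3, Prod.snd_zero, Prod.fst_zero]; field_simp; ring
  · simp
  · simp only [e5, Prod.snd_zero, Prod.fst_zero]; ring
  · simp only [Prod.snd_zero]; field_simp; ring

theorem contDiff_avgFieldClosed (hδ : 0 < P.δ) (a : ℝ) : ContDiff ℝ 1 (P.avgFieldClosed a) := by
  have hsm := contDiff_smoothMax hδ
  have hH : ContDiff ℝ 1 fun x : Vec n => P.H.toEuclideanLin x :=
    (LinearMap.toContinuousLinearMap P.H.toEuclideanLin).contDiff
  unfold avgFieldClosed State.param State.gradJ State.etaJ State.gradh State.etah State.gamma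
  simp only [J_param_add, h_param_add]
  have hnorm : ContDiff ℝ 1 fun x : State n => ‖x.2.2.2.1‖ ^ 2 := by
    exact ContDiff.norm_sq ℝ (by fun_prop)
  have hHx : ContDiff ℝ 1 fun x : State n => P.H.toEuclideanLin x.1 := hH.comp contDiff_fst
  have hsmx : ContDiff ℝ 1 fun x : State n =>
      smoothMax P.δ (P.k * ⟪x.2.1, x.2.2.2.1⟫ - P.c * x.2.2.2.2.1) := by
    refine hsm.comp (((contDiff_const).mul (ContDiff.inner ℝ ?_ ?_)).sub ?_) <;> fun_prop
  have hJ : ContDiff ℝ 1 fun x : State n => ⟪x.1, P.H.toEuclideanLin x.1⟫ :=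
    ContDiff.inner ℝ contDiff_fst hHx
  have hhx : ContDiff ℝ 1 fun x : State n => ⟪P.h₁, x.1⟫ :=
    ContDiff.inner ℝ contDiff_const contDiff_fst
  fun_prop

/-- The derivative of the averaged field at `x` in the direction `v`. -/
noncomputable def linField (P : Data n) (x v : State n) : State n :=
  let s := P.k * ⟪x.gradJ, x.gradh⟫ - P.c * x.etah
  let ds := P.k * (⟪x.gradJ, v.gradh⟫ + ⟪v.gradJ, x.gradh⟫) - P.c * v.etah
  (-(P.k • v.gradJ)
      + ((x.gamma * smoothMax P.δ s) • v.gradh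
        + (v.gamma * smoothMax P.δ s
          + x.gamma * ((1 + s / Real.sqrt (s ^ 2 + P.δ)) / 2 * ds)) • x.gradh),
   -(P.ωf • v.gradJ) + P.ωf • P.H.toEuclideanLin v.param,
   -(P.ωf * v.etaJ) + P.ωf * (1 / 2 * (⟪x.param, P.H.toEuclideanLin v.param⟫
      + ⟪v.param, P.H.toEuclideanLin x.param⟫)),
   -(P.ωf • v.gradh),
   -(P.ωf * v.etah) + P.ωf * ⟪P.h₁, v.param⟫,
   P.ωf * v.gamma * (1 - x.gamma * ‖x.gradh‖ ^ 2)
      + P.ωf * x.gamma * -(v.gamma * ‖x.gradh‖ ^ 2 + x.gamma * (2 * ⟪x.gradh, v.gradh⟫)))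

theorem hasDerivAt_avgFieldClosed_comp (hδ : 0 < P.δ) (a : ℝ) {X : ℝ → State n} {v : State n}
    {t : ℝ} (hX : HasDerivAt X v t) :
    HasDerivAt (fun s => P.avgFieldClosed a (X s)) (P.linField (X t) v) t := by
  have h1 : HasDerivAt (fun s => (X s).param) v.param t := hX.fst
  have h2 : HasDerivAt (fun s => (X s).gradJ) v.gradJ t := hX.snd.fst
  have h3 : HasDerivAt (fun s => (X s).etaJ) v.etaJ t := hX.snd.snd.fst
  have h4 : HasDerivAt (fun s => (X s).gradh) v.gradh t := hX.snd.snd.snd.fst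
  have h5 : HasDerivAt (fun s => (X s).etah) v.etah t := hX.snd.snd.snd.snd.fst
  have h6 : HasDerivAt (fun s => (X s).gamma) v.gamma t := hX.snd.snd.snd.snd.snd
  have hH : HasDerivAt (fun s => P.H.toEuclideanLin (X s).param)
      (P.H.toEuclideanLin v.param) t :=
    (LinearMap.toContinuousLinearMap P.H.toEuclideanLin).hasFDerivAt.comp_hasDerivAt t h1
  have harg := ((h2.inner ℝ h4).const_mul P.k).sub (h5.const_mul P.c)
  have hsm := (hasDerivAt_smoothMax hδ _).comp t harg
  unfold avgFieldClosed
  simp only [J_param_add, h_param_add]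
  refine HasDerivAt.prodMk ?_ (HasDerivAt.prodMk ?_ (HasDerivAt.prodMk ?_
    (HasDerivAt.prodMk ?_ (HasDerivAt.prodMk ?_ ?_))))
  · exact (h2.const_smul P.k).neg.add ((h6.mul hsm).smul h4)
  · exact (h2.const_smul P.ωf).neg.add (hH.const_smul P.ωf)
  · exact (h3.const_mul P.ωf).neg.add
      (((((h1.inner ℝ hH).const_mul (1 / 2)).const_add P.Jstar).add_const _).const_mul P.ωf)
  · exact ((h4.const_smul P.ωf).neg.add_const _)
  · refine (h5.const_mul P.ωf).neg.add (HasDerivAt.const_mul P.ωf (HasDerivAt.const_add P.h₀ ?_))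
    simpa using (hasDerivAt_const t P.h₁).inner ℝ h1
  · exact (h6.const_mul P.ωf).mul ((h6.mul h4.norm_sq).const_sub 1)

theorem fderiv_avgFieldClosed (hδ : 0 < P.δ) (a : ℝ) (x v : State n) :
    fderiv ℝ (P.avgFieldClosed a) x v = P.linField x v := by
  have hline : HasDerivAt (fun t : ℝ => x + t • v) v 0 := by
    simpa using ((hasDerivAt_id (0 : ℝ)).smul_const v).const_add x
  have h1 := hasDerivAt_avgFieldClosed_comp (P := P) hδ a hline
  have hx : x + (0 : ℝ) • v = x := by simp
  have hd : HasFDerivAt (P.avgFieldClosed a) (fderiv ℝ (P.avgFieldClosed a) x)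
      (x + (0 : ℝ) • v) := by
    rw [hx]
    exact ((contDiff_avgFieldClosed hδ a).differentiable one_ne_zero x).hasFDerivAt
  have h2 := hd.comp_hasDerivAt (0 : ℝ) hline
  rw [hx] at h1
  exact h2.unique h1

end Data

/-! ### Stability of the linearization -/

namespace Data

variable {n : ℕ} {P : Data n}

/-- The linearization at the equilibrium is a cascade. The filter for `G_h`, the combination
`η_h - h₁ᵀ H⁻¹ G_J` and the Riccati filter `γ` are first-order filters that drive the second-order
system of `Z = H⁻¹ G_J` and `V = θ - Z`, which in turn drives the first-order filter for `η_J`.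
In the second-order system `dθ/dt = -Q T Z`, where `Q = 1 - μ h₁ h₁ᵀ / ‖h₁‖²`, with `μ ∈ (0, 1)` the
slope of the smooth maximum, and `T = k H + μ c / ((1 - μ) ‖h₁‖²) h₁ h₁ᵀ`; both are positive
definite, and `S = Q⁻¹`. -/
theorem exists_lyapunov_fderiv_avgFieldClosed (hH : P.H.PosDef) (hh₁ : P.h₁ ≠ 0) (hk : 0 < P.k)
    (hc : 0 < P.c) (hδ : 0 < P.δ) (hωf : 0 < P.ωf) (a : ℝ) :
    ∃ B : State n →L[ℝ] State n →L[ℝ] ℝ, (∀ x y, B x y = B y x) ∧ ∃ m > 0,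
      (∀ x, m * ‖x‖ ^ 2 ≤ B x x) ∧
      ∀ x, B x (fderiv ℝ (P.avgFieldClosed a) (P.equilibrium a) x) ≤ -m * ‖x‖ ^ 2 := by
  have hn : 0 < ‖P.h₁‖ := norm_pos_iff.2 hh₁
  let Hc : Vec n →L[ℝ] Vec n := LinearMap.toContinuousLinearMap P.H.toEuclideanLin
  let Hi : Vec n →L[ℝ] Vec n := LinearMap.toContinuousLinearMap P.H⁻¹.toEuclideanLin
  have hHi : ∀ u, Hi (P.H.toEuclideanLin u) = u := toEuclideanLin_inv_mul hH
  have hHc : ∀ u, Hc (Hi u) = u := toEuclideanLin_mul_inv hH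
  let p₁ : State n →L[ℝ] Vec n := .fst ℝ _ _
  let s₁ : State n →L[ℝ] Vec n × ℝ × Vec n × ℝ × ℝ := .snd ℝ _ _
  let p₂ : State n →L[ℝ] Vec n := .fst ℝ _ _ ∘L s₁
  let s₂ : State n →L[ℝ] ℝ × Vec n × ℝ × ℝ := .snd ℝ _ _ ∘L s₁
  let p₃ : State n →L[ℝ] ℝ := .fst ℝ _ _ ∘L s₂
  let s₃ : State n →L[ℝ] Vec n × ℝ × ℝ := .snd ℝ _ _ ∘L s₂
  let p₄ : State n →L[ℝ] Vec n := .fst ℝ _ _ ∘L s₃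
  let s₄ : State n →L[ℝ] ℝ × ℝ := .snd ℝ _ _ ∘L s₃
  let p₅ : State n →L[ℝ] ℝ := .fst ℝ _ _ ∘L s₄
  let p₆ : State n →L[ℝ] ℝ := .snd ℝ _ _ ∘L s₄
  let Z : State n →L[ℝ] Vec n := Hi ∘L p₂
  let V : State n →L[ℝ] Vec n := p₁ - Z
  let e : State n →L[ℝ] ℝ := p₅ - innerSL ℝ P.h₁ ∘L Z
  set L := fderiv ℝ (P.avgFieldClosed a) (P.equilibrium a) with hL
  have hLx : ∀ x, L x = P.linField (P.equilibrium a) x := fderiv_avgFieldClosed hδ a _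
  have hZx : ∀ x : State n, Z x = Hi x.gradJ := fun _ => rfl
  have hVx : ∀ x : State n, V x = x.param - Hi x.gradJ := fun _ => rfl
  have hex : ∀ x : State n, e x = x.etah - ⟪P.h₁, Hi x.gradJ⟫ := fun _ => rfl
  have hZL : ∀ x, Z (L x) = P.ωf • V x := by
    intro x
    rw [hLx, hVx]
    change Hi (-(P.ωf • x.gradJ) + P.ωf • P.H.toEuclideanLin x.param) = _
    rw [map_add, map_neg, map_smul, map_smul, hHi, smul_sub]
    abel
  obtain ⟨hμ0, hμ1⟩ := smoothMax_slope_mem_Ioo hδ P.eqArg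
  set μ := (1 + P.eqArg / Real.sqrt (P.eqArg ^ 2 + P.δ)) / 2 with hμ
  have hμ1' : 0 < 1 - μ := by linarith
  -- the rank-one map `u ↦ ⟪h₁, u⟫ h₁`
  let R : Vec n →L[ℝ] Vec n := (innerSL ℝ P.h₁).smulRight P.h₁
  have hR : ∀ u, R u = ⟪P.h₁, u⟫ • P.h₁ := fun _ => rfl
  set α := μ / ((1 - μ) * ‖P.h₁‖ ^ 2) with hα
  have hαpos : 0 < α := by positivity
  let S : Vec n →L[ℝ] Vec n := .id ℝ _ + α • R
  let T : Vec n →L[ℝ] Vec n := P.k • Hc + (α * P.c) • R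
  have hS : ∀ u, S u = u + (α * ⟪P.h₁, u⟫) • P.h₁ := fun u => by simp [S, hR, smul_smul]
  have hT : ∀ u, T u = P.k • P.H.toEuclideanLin u + (α * P.c * ⟪P.h₁, u⟫) • P.h₁ := fun u => by
    simp [T, hR, smul_smul, Hc]
  have hSin : ∀ u v, ⟪u, S v⟫ = ⟪u, v⟫ + α * (⟪P.h₁, v⟫ * ⟪P.h₁, u⟫) := fun u v => by
    rw [hS, inner_add_right, real_inner_smul_right, real_inner_comm P.h₁ u]; ring
  have hTin : ∀ u v, ⟪u, T v⟫
      = P.k * ⟪u, P.H.toEuclideanLin v⟫ + α * P.c * (⟪P.h₁, v⟫ * ⟪P.h₁, u⟫) := fun u v => by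
    rw [hT, inner_add_right, real_inner_smul_right, real_inner_smul_right,
      real_inner_comm P.h₁ u]; ring
  obtain ⟨b, hb, hTb⟩ := exists_coercive T fun u hu => by
    have h1 := mul_pos hk (inner_toEuclideanLin_pos hH hu)
    have h2 : 0 ≤ α * P.c * (⟪P.h₁, u⟫ * ⟪P.h₁, u⟫) :=
      mul_nonneg (by positivity) (mul_self_nonneg _)
    rw [hTin]
    linarith
  have D₁ : DecaysAlong L (p₄.prod (0 : State n →L[ℝ] ℝ)) :=
    (decaysAlong_zero L).filter hωf fun x _ => by rw [hLx]; rfl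
  have D₂ := D₁.filter (P := e) hωf fun x _ => by
    have h1 : e (L x) = -(P.ωf * x.etah) + P.ωf * ⟪P.h₁, x.param⟫ - ⟪P.h₁, Z (L x)⟫ := by
      rw [hLx]; rfl
    rw [h1, hZL, hVx, hex, real_inner_smul_right, inner_sub_right, smul_eq_mul]
    ring
  have D₃ := D₂.filter (P := p₆) hωf fun x hx => by
    simp only [ContinuousLinearMap.prod_apply, Prod.mk_eq_zero] at hx
    have hx4 : x.gradh = 0 := hx.2.1
    rw [hLx]
    change P.ωf * x.gamma * (1 - 1 / ‖P.h₁‖ ^ 2 * ‖P.h₁‖ ^ 2) + P.ωf * (1 / ‖P.h₁‖ ^ 2)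
      * -(x.gamma * ‖P.h₁‖ ^ 2 + 1 / ‖P.h₁‖ ^ 2 * (2 * ⟪P.h₁, x.gradh⟫)) = -(P.ωf • x.gamma)
    rw [hx4, inner_zero_right, smul_eq_mul]
    field_simp
    ring
  have D₄ := D₃.secondOrder (Z := Z) (V := V) (S := S) (T := T) hωf one_pos hb
    (fun u v => by rw [hSin, hSin, real_inner_comm]; ring)
    (fun u v => by rw [hTin, hTin, inner_toEuclideanLin_comm hH]; ring)
    (fun u => by
      rw [hSin, real_inner_self_eq_norm_sq, one_mul]
      exact le_add_of_nonneg_right (mul_nonneg hαpos.le (mul_self_nonneg _)))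
    hTb (fun x _ => hZL x) fun x hx => by
      simp only [ContinuousLinearMap.prod_apply, Prod.mk_eq_zero] at hx
      have hx6 : x.gamma = 0 := hx.1
      have hx4 : x.gradh = 0 := hx.2.2.1
      have hx5 : x.etah = ⟪P.h₁, Z x⟫ := sub_eq_zero.1 hx.2.1
      have hg : x.gradJ = P.H.toEuclideanLin (Z x) := (hHc x.gradJ).symm
      have hp : p₁ (L x) = -(P.k • P.H.toEuclideanLin (Z x))
          + (μ / ‖P.h₁‖ ^ 2 * (P.k * ⟪P.h₁, P.H.toEuclideanLin (Z x)⟫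
            - P.c * ⟪P.h₁, Z x⟫)) • P.h₁ := by
        rw [hLx, ← hg, ← hx5]
        change -(P.k • x.gradJ) + ((1 / ‖P.h₁‖ ^ 2 * smoothMax P.δ P.eqArg) • x.gradh
          + (x.gamma * smoothMax P.δ P.eqArg + 1 / ‖P.h₁‖ ^ 2 * (μ * (P.k *
            (⟪P.eqGradJ, x.gradh⟫ + ⟪x.gradJ, P.h₁⟫) - P.c * x.etah))) • P.h₁) = _
        rw [hx4, hx6, inner_zero_right, smul_zero, real_inner_comm x.gradJ]
        congr 1
        rw [zero_add]
        congr 1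
        ring
      have hV : V (L x) = p₁ (L x) - P.ωf • V x := by
        rw [← hZL]; rfl
      rw [hV, map_sub, map_smul, hp]
      congr 1
      rw [hT, hS, inner_add_right, inner_neg_right, real_inner_smul_right, real_inner_smul_right,
        real_inner_self_eq_norm_sq]
      rw [neg_add, add_assoc, ← add_smul, ← neg_smul (α * P.c * _)]
      congr 2
      rw [hα]
      field_simp
      ring
  have D₅ := D₄.filter (P := p₃) hωf fun x hx => by
    simp only [ContinuousLinearMap.prod_apply, Prod.mk_eq_zero] at hx
    have hz : Hi x.gradJ = 0 := hx.1.1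
    have h0 : x.param = 0 := by
      have := hx.1.2
      rw [hVx, hz, sub_zero] at this
      exact this
    rw [hLx]
    change -(P.ωf * x.etaJ) + P.ωf * (1 / 2 * (⟪_, P.H.toEuclideanLin x.param⟫
      + ⟪x.param, _⟫)) = -(P.ωf • x.etaJ)
    rw [h0, map_zero, inner_zero_right, inner_zero_left, smul_eq_mul]
    ring
  refine D₅.exists_lyapunov fun x hx => ?_
  simp only [ContinuousLinearMap.prod_apply, Prod.mk_eq_zero] at hx
  obtain ⟨h3, ⟨hz, hv⟩, h6, h5, h4, -⟩ := hx
  have h2 : x.gradJ = 0 := by rw [← hHc x.gradJ, ← hZx, hz, map_zero]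
  have h1 : x.param = 0 := by
    rw [hVx, ← hZx, hz, sub_zero] at hv
    exact hv
  have h5' : x.etah = 0 := by
    rw [hex, ← hZx, hz, inner_zero_right, sub_zero] at h5
    exact h5
  exact Prod.ext h1 (Prod.ext h2 (Prod.ext h3 (Prod.ext h4 (Prod.ext h5' h6))))

end Data

/-! ### The averaging period and the oscillatory part of the field -/

/-- For commensurable frequencies the least common multiple of the `1 / v i` is attained, because
all common multiples are natural multiples of `1 / v i₀`. -/
theorem realLCM_spec {n : ℕ} {v : Fin n → ℝ} (i₀ : Fin n) (hv : ∀ i, 0 < v i)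
    (hrat : ∀ i j, ∃ r : ℚ, v i / v j = (r : ℝ)) :
    0 < realLCM (fun i => 1 / v i) ∧
      ∀ i, ∃ m : ℕ, realLCM (fun i => 1 / v i) = m * (1 / v i) := by
  classical
  set A : Set ℝ := {L : ℝ | 0 < L ∧ ∀ i, ∃ m : ℕ, L = m * (1 / v i)} with hA
  have hv0 := hv i₀
  have hex : ∃ m : ℕ, (m : ℝ) * (1 / v i₀) ∈ A := by
    choose r hr using fun i => hrat i i₀
    have hrpos : ∀ i, 0 < r i := fun i => by
      have : (0 : ℝ) < r i := by rw [← hr]; exact div_pos (hv i) hv0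
      exact_mod_cast this
    refine ⟨∏ i, (r i).den, ?_, fun i => ?_⟩
    · have : 0 < ∏ i, (r i).den := Finset.prod_pos fun i _ => (r i).den_pos
      have : (0 : ℝ) < ((∏ i, (r i).den : ℕ) : ℝ) := by exact_mod_cast this
      positivity
    · obtain ⟨c, hc⟩ : (r i).den ∣ ∏ i, (r i).den := Finset.dvd_prod_of_mem _ (Finset.mem_univ i)
      refine ⟨c * (r i).num.natAbs, ?_⟩
      have hnum : (((r i).num.natAbs : ℕ) : ℝ) = (r i).den * (v i / v i₀) := by
        rw [hr]
        have h1 : ((r i).num.natAbs : ℤ) = (r i).num :=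
          Int.natAbs_of_nonneg (Rat.num_nonneg.2 (hrpos i).le)
        have h2 : (r i).den * r i = (r i).num := Rat.den_mul_eq_num (r i)
        have h3 : (((r i).den * r i : ℚ) : ℝ) = (((r i).num : ℚ) : ℝ) := by rw [h2]
        push_cast at h3
        rw [h3, ← h1]
        simp
      rw [hc]
      push_cast
      rw [hnum]
      have := hv i
      field_simp
  have hleast : IsLeast A ((Nat.find hex : ℕ) * (1 / v i₀)) := by
    refine ⟨Nat.find_spec hex, fun L hL => ?_⟩
    obtain ⟨m, rfl⟩ := hL.2 i₀
    have : (Nat.find hex : ℝ) ≤ m := by exact_mod_cast Nat.find_min' hex hL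
    gcongr
  have heq : realLCM (fun i => 1 / v i) = (Nat.find hex : ℕ) * (1 / v i₀) := hleast.csInf_eq
  rw [heq]
  exact hleast.1

section

variable {E F G : Type*} [NormedAddCommGroup E] [NormedSpace ℝ E] [NormedAddCommGroup F]
  [NormedSpace ℝ F] [NormedAddCommGroup G] [NormedSpace ℝ G] {p : ℝ}

theorem IsOscillatory.congr {g g' : ℝ → E → F} (h : IsOscillatory p g)
    (he : ∀ τ x, g' τ x = g τ x) : IsOscillatory p g' := by
  rwa [funext fun τ => funext (he τ)]

theorem IsOscillatory.prodMk {g₁ : ℝ → E → F} {g₂ : ℝ → E → G} (h₁ : IsOscillatory p g₁)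
    (h₂ : IsOscillatory p g₂) : IsOscillatory p (fun τ x => (g₁ τ x, g₂ τ x)) := by
  simpa using (h₁.clm_comp (.inl ℝ F G)).add (h₂.clm_comp (.inr ℝ F G))

theorem IsOscillatory.const_smul {g : ℝ → E → F} (h : IsOscillatory p g) (c : ℝ) :
    IsOscillatory p (fun τ x => c • g τ x) := by
  simpa using h.clm_comp (c • .id ℝ F)

theorem IsOscillatory.of_coord {n : ℕ} {g : ℝ → E → Vec n}
    (h : ∀ l, IsOscillatory p (fun τ x => g τ x l)) : IsOscillatory p g := by
  have h1 := IsOscillatory.sum Finset.univ fun l =>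
    (h l).clm_comp (ContinuousLinearMap.toSpanSingleton ℝ (EuclideanSpace.single l (1 : ℝ)))
  convert h1 using 3 with τ x
  ext l
  simp [Finset.sum_apply, Pi.single_apply]

end

namespace Data

variable {n : ℕ} {P : Data n}

theorem period_pos_and_freq_mul_period (hh₁ : P.h₁ ≠ 0) (hfreq : ∀ i, 0 < P.freq i)
    (hrat : ∀ i j, ∃ r : ℚ, P.freq i / P.freq j = (r : ℝ)) :
    0 < P.period ∧ ∀ i, ∃ k : ℤ, P.freq i * P.period = k * (2 * Real.pi) := by
  obtain ⟨i₀⟩ : Nonempty (Fin n) := by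
    by_contra hemp
    rw [not_nonempty_iff] at hemp
    exact hh₁ (Subsingleton.elim _ _)
  obtain ⟨hpos, hmul⟩ := realLCM_spec i₀ hfreq hrat
  refine ⟨by unfold period; positivity, fun i => ?_⟩
  obtain ⟨m, hm⟩ := hmul i
  have := hfreq i
  refine ⟨m, ?_⟩
  rw [period, hm]
  push_cast
  field_simp

theorem isZeroMean_sin_mul_sin_sub (hp : ∀ i, ∃ k : ℤ, P.freq i * P.period = k * (2 * Real.pi))
    (hfreq : ∀ i, 0 < P.freq i) (hne : ∀ i j, i ≠ j → P.freq i ≠ P.freq j) (i j : Fin n) :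
    IsZeroMean P.period (fun τ => Real.sin (P.freq i * τ) * Real.sin (P.freq j * τ)
      - if i = j then 1 / 2 else 0) := by
  have hi := hfreq i
  have hj := hfreq j
  rcases eq_or_ne i j with rfl | hij
  · simpa using isZeroMean_sin_mul_self (hp i) hi.ne'
  · simpa [hij] using isZeroMean_sin_mul_sin (hp i) (hp j) (sub_ne_zero.2 (hne i j hij))
      (by positivity)

theorem pert_apply (a τ : ℝ) (w : Fin n → ℝ) (i : Fin n) :
    pert a w τ i = a * Real.sin (w i * τ) := rfl

theorem demod_apply (a τ : ℝ) (w : Fin n → ℝ) (i : Fin n) :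
    demod a w τ i = 2 / a * Real.sin (w i * τ) := rfl

theorem sum_mul_sub_ite (f : Fin n → ℝ) (s : Fin n → ℝ) (l : Fin n) :
    ∑ i, (s i * s l - if i = l then 1 / 2 else 0) * f i
      = (∑ i, s i * f i) * s l - 1 / 2 * f l := by
  simp only [sub_mul, Finset.sum_sub_distrib, ite_mul, zero_mul, Finset.sum_ite_eq',
    Finset.mem_univ, if_true, Finset.sum_mul]
  congr 1
  exact Finset.sum_congr rfl fun i _ => by ring

/-- The objective seen through the dither: value, first-order and second-order terms. -/
theorem J_add_pert (hH : P.H.PosDef) (a τ : ℝ) (x : Vec n) :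
    P.J (x + P.θstar + pert a P.freq τ) = P.J (x + P.θstar)
      + ∑ i, Real.sin (P.freq i * τ) * (a * (P.H.toEuclideanLin x) i)
      + ∑ i, ∑ j, Real.sin (P.freq i * τ) * Real.sin (P.freq j * τ) * (a ^ 2 / 2 * P.H i j) := by
  set S := pert a P.freq τ with hS
  have h1 : x + P.θstar + S = (x + S) + P.θstar := by abel
  have h2 : ⟪S, P.H.toEuclideanLin x⟫
      = ∑ i, Real.sin (P.freq i * τ) * (a * (P.H.toEuclideanLin x) i) := by
    rw [PiLp.inner_apply]
    refine Finset.sum_congr rfl fun i _ => ?_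
    rw [hS, pert_apply, RCLike.inner_apply, conj_trivial]
    ring
  have h3 : ⟪S, P.H.toEuclideanLin S⟫ = 2 * ∑ i, ∑ j, Real.sin (P.freq i * τ)
      * Real.sin (P.freq j * τ) * (a ^ 2 / 2 * P.H i j) := by
    rw [PiLp.inner_apply, Finset.mul_sum]
    refine Finset.sum_congr rfl fun i _ => ?_
    have hrow : (P.H.toEuclideanLin S) i = ∑ j, P.H i j * S j := rfl
    rw [RCLike.inner_apply, conj_trivial, hrow, Finset.sum_mul, Finset.mul_sum]
    refine Finset.sum_congr rfl fun j _ => ?_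
    rw [hS, pert_apply, pert_apply]
    ring
  rw [h1, J_param_add, J_param_add, map_add, inner_add_left, inner_add_right, inner_add_right, h3,
    inner_toEuclideanLin_comm hH x S, h2]
  ring

theorem h_add_pert (a τ : ℝ) (x : Vec n) :
    P.h (x + P.θstar + pert a P.freq τ) = P.h (x + P.θstar)
      + ∑ i, Real.sin (P.freq i * τ) * (a * P.h₁ i) := by
  have h1 : x + P.θstar + pert a P.freq τ = (x + pert a P.freq τ) + P.θstar := by abel
  rw [h1, h_param_add, h_param_add, inner_add_right, PiLp.inner_apply P.h₁ (pert a P.freq τ),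
    add_assoc]
  congr 2
  refine Finset.sum_congr rfl fun i _ => ?_
  rw [pert_apply, RCLike.inner_apply, conj_trivial]
  ring

/-- In each component the difference between the field and the closed form is a trigonometric sum
in `τ` with zero mean and coefficients that are polynomial in `x`. -/
theorem isOscillatory_errorField_sub (hH : P.H.PosDef)
    (hp : ∀ i, ∃ k : ℤ, P.freq i * P.period = k * (2 * Real.pi))
    (hfreq : ∀ i, 0 < P.freq i) (hne : ∀ i j, i ≠ j → P.freq i ≠ P.freq j) {a : ℝ} (ha : 0 < a) :
    IsOscillatory P.period (fun τ x => P.errorField a τ x - P.avgFieldClosed a x) := by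
  have hHv : ContDiff ℝ 1 fun x : State n => P.H.toEuclideanLin x.1 :=
    (LinearMap.toContinuousLinearMap P.H.toEuclideanLin).contDiff.comp contDiff_fst
  have hHx : ∀ i, ContDiff ℝ 1 fun x : State n => (P.H.toEuclideanLin x.1) i := fun i =>
    (EuclideanSpace.proj i : Vec n →L[ℝ] ℝ).contDiff.comp hHv
  have hJx : ContDiff ℝ 1 fun x : State n => P.J (x.1 + P.θstar) := by
    simp only [J_param_add]
    exact contDiff_const.add (contDiff_const.mul (ContDiff.inner ℝ contDiff_fst hHv))
  have hhx : ContDiff ℝ 1 fun x : State n => P.h (x.1 + P.θstar) := by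
    simp only [h_param_add]
    exact contDiff_const.add (ContDiff.inner ℝ contDiff_const contDiff_fst)
  have hone : ∀ i, IsZeroMean P.period fun τ => Real.sin (P.freq i * τ) := fun i =>
    isZeroMean_sin (hp i)
  have htwo := isZeroMean_sin_mul_sin_sub hp hfreq hne
  have hthree : ∀ i j l, IsZeroMean P.period fun τ =>
      Real.sin (P.freq i * τ) * Real.sin (P.freq j * τ) * Real.sin (P.freq l * τ) :=
    fun i j l => isZeroMean_sin_mul_sin_mul_sin (hp i) (hp j) (hp l)
  have hJ : IsOscillatory P.period (fun τ (x : State n) =>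
      P.J (x.1 + P.θstar + pert a P.freq τ)
        - (P.J (x.1 + P.θstar) + a ^ 2 / 4 * P.H.trace)) := by
    have h1 := (IsOscillatory.sum Finset.univ fun i => IsOscillatory.smul (hone i)
      (contDiff_const.mul (hHx i) : ContDiff ℝ 1 fun x : State n =>
        a * (P.H.toEuclideanLin x.1) i)).add
      (IsOscillatory.sum Finset.univ fun i => IsOscillatory.sum Finset.univ fun j =>
        IsOscillatory.smul (htwo i j)
          (contDiff_const : ContDiff ℝ 1 fun _ : State n => a ^ 2 / 2 * P.H i j))
    refine h1.congr fun τ x => ?_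
    rw [J_add_pert hH]
    simp only [smul_eq_mul, sub_mul, Finset.sum_sub_distrib, ite_mul, zero_mul,
      Finset.sum_ite_eq, Finset.mem_univ, if_true, Matrix.trace, Matrix.diag_apply]
    have h4 : ∑ i, 1 / 2 * (a ^ 2 / 2 * P.H i i) = a ^ 2 / 4 * ∑ i, P.H i i := by
      rw [Finset.mul_sum]
      exact Finset.sum_congr rfl fun i _ => by ring
    rw [h4]
    ring
  have hh : IsOscillatory P.period (fun τ (x : State n) =>
      P.h (x.1 + P.θstar + pert a P.freq τ) - P.h (x.1 + P.θstar)) := by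
    have h1 := IsOscillatory.sum Finset.univ fun i => IsOscillatory.smul (hone i)
      (contDiff_const : ContDiff ℝ 1 fun _ : State n => a * P.h₁ i)
    refine h1.congr fun τ x => ?_
    rw [h_add_pert]
    simp
  have hGJ : IsOscillatory P.period (fun τ (x : State n) =>
      (P.J (x.1 + P.θstar + pert a P.freq τ) - x.2.2.1) • demod a P.freq τ
        - P.H.toEuclideanLin x.1) := by
    refine IsOscillatory.of_coord fun l => ?_
    have h1 := ((IsOscillatory.smul (hone l)
      (contDiff_const.mul (hJx.sub (by fun_prop)) : ContDiff ℝ 1 fun x : State n =>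
        2 / a * (P.J (x.1 + P.θstar) - x.2.2.1))).add
      (IsOscillatory.sum Finset.univ fun i => IsOscillatory.smul (htwo i l)
        (contDiff_const.mul (hHx i) : ContDiff ℝ 1 fun x : State n =>
          2 * (P.H.toEuclideanLin x.1) i))).add
      (IsOscillatory.sum Finset.univ fun i => IsOscillatory.sum Finset.univ fun j =>
        IsOscillatory.smul (hthree i j l)
          (contDiff_const : ContDiff ℝ 1 fun _ : State n => a * P.H i j))
    refine h1.congr fun τ x => ?_
    rw [PiLp.sub_apply, PiLp.smul_apply, demod_apply, J_add_pert hH]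
    simp only [smul_eq_mul]
    rw [sum_mul_sub_ite (fun i => 2 * (P.H.toEuclideanLin x.1) i)
      (fun i => Real.sin (P.freq i * τ)) l]
    have h4 : ∑ i, Real.sin (P.freq i * τ) * (a * (P.H.toEuclideanLin x.1) i)
        = a / 2 * ∑ i, Real.sin (P.freq i * τ) * (2 * (P.H.toEuclideanLin x.1) i) := by
      rw [Finset.mul_sum]
      exact Finset.sum_congr rfl fun i _ => by ring
    have h5 : ∑ i, ∑ j, Real.sin (P.freq i * τ) * Real.sin (P.freq j * τ)
          * Real.sin (P.freq l * τ) * (a * P.H i j)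
        = 2 / a * Real.sin (P.freq l * τ) * ∑ i, ∑ j, Real.sin (P.freq i * τ)
          * Real.sin (P.freq j * τ) * (a ^ 2 / 2 * P.H i j) := by
      simp only [Finset.mul_sum]
      refine Finset.sum_congr rfl fun i _ => Finset.sum_congr rfl fun j _ => ?_
      field_simp
    rw [h4, h5]
    beta_reduce
    generalize ∑ i, Real.sin (P.freq i * τ) * (2 * (P.H.toEuclideanLin x.1) i) = σ₁
    generalize ∑ i, ∑ j, Real.sin (P.freq i * τ) * Real.sin (P.freq j * τ)
      * (a ^ 2 / 2 * P.H i j) = σ₂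
    field_simp
    ring
  have hGh : IsOscillatory P.period (fun τ (x : State n) =>
      (P.h (x.1 + P.θstar + pert a P.freq τ) - x.2.2.2.2.1) • demod a P.freq τ - P.h₁) := by
    refine IsOscillatory.of_coord fun l => ?_
    have h1 := (IsOscillatory.smul (hone l)
      (contDiff_const.mul (hhx.sub (by fun_prop)) : ContDiff ℝ 1 fun x : State n =>
        2 / a * (P.h (x.1 + P.θstar) - x.2.2.2.2.1))).add
      (IsOscillatory.sum Finset.univ fun i => IsOscillatory.smul (htwo i l)
        (contDiff_const : ContDiff ℝ 1 fun _ : State n => 2 * P.h₁ i))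
    refine h1.congr fun τ x => ?_
    rw [PiLp.sub_apply, PiLp.smul_apply, demod_apply, h_add_pert]
    simp only [smul_eq_mul]
    rw [sum_mul_sub_ite (fun i => 2 * P.h₁ i) (fun i => Real.sin (P.freq i * τ)) l]
    have h4 : ∑ i, Real.sin (P.freq i * τ) * (a * P.h₁ i)
        = a / 2 * ∑ i, Real.sin (P.freq i * τ) * (2 * P.h₁ i) := by
      rw [Finset.mul_sum]
      exact Finset.sum_congr rfl fun i _ => by ring
    rw [h4]
    beta_reduce
    generalize ∑ i, Real.sin (P.freq i * τ) * (2 * P.h₁ i) = σ₁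
    field_simp
    ring
  have h := (IsOscillatory.zero (p := P.period) (E := State n) (F := Vec n)).prodMk
    ((hGJ.const_smul P.ωf).prodMk ((hJ.const_smul P.ωf).prodMk ((hGh.const_smul P.ωf).prodMk
      ((hh.const_smul P.ωf).prodMk (IsOscillatory.zero (F := ℝ))))))
  refine h.congr fun τ x => ?_
  simp only [errorField, field, ofError, avgFieldClosed, State.param, State.gradJ, State.etaJ,
    State.gradh, State.etah, State.gamma, Prod.mk_sub_mk, smul_sub, smul_smul, smul_eq_mul]
  refine Prod.ext ?_ (Prod.ext ?_ (Prod.ext ?_ (Prod.ext ?_ (Prod.ext ?_ ?_))))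
  · simp
  · dsimp only; abel
  · dsimp only; ring
  · dsimp only; abel
  · dsimp only; ring
  · simp

theorem avgField_eq_avgFieldClosed (hH : P.H.PosDef) (hpos : 0 < P.period)
    (hp : ∀ i, ∃ k : ℤ, P.freq i * P.period = k * (2 * Real.pi))
    (hfreq : ∀ i, 0 < P.freq i) (hne : ∀ i j, i ≠ j → P.freq i ≠ P.freq j) {a : ℝ} (ha : 0 < a)
    (x : State n) : P.avgField a x = P.avgFieldClosed a x := by
  have hosc := isOscillatory_errorField_sub hH hp hfreq hne ha
  have hcont := hosc.continuous x
  have h1 : (fun τ => P.errorField a τ x) = fun τ =>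
      (P.errorField a τ x - P.avgFieldClosed a x) + P.avgFieldClosed a x := by
    funext τ; abel
  rw [avgField, h1, intervalIntegral.integral_add (hcont.intervalIntegrable _ _)
    (continuous_const.intervalIntegrable _ _), hosc.integral_eq_zero x,
    intervalIntegral.integral_const, zero_add, sub_zero, smul_smul, one_div,
    inv_mul_cancel₀ hpos.ne', one_smul]

end Data

/-! ### Return to the original coordinates -/

section Norms

variable {n : ℕ}

theorem norm_le_euclNorm (x : State n) : ‖x‖ ≤ x.euclNorm := by
  have h : ∀ {y : ℝ}, 0 ≤ y → y ^ 2 ≤ ‖x.param‖ ^ 2 + ‖x.gradJ‖ ^ 2 + x.etaJ ^ 2 + ‖x.gradh‖ ^ 2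
      + x.etah ^ 2 + x.gamma ^ 2 → y ≤ x.euclNorm := fun _ h => Real.le_sqrt_of_sq_le h
  have p1 := sq_nonneg ‖x.param‖
  have p2 := sq_nonneg ‖x.gradJ‖
  have p3 := sq_nonneg x.etaJ
  have p4 := sq_nonneg ‖x.gradh‖
  have p5 := sq_nonneg x.etah
  have p6 := sq_nonneg x.gamma
  refine norm_prod_le_iff.2 ⟨h (norm_nonneg _) ?_, norm_prod_le_iff.2 ⟨h (norm_nonneg _) ?_,
    norm_prod_le_iff.2 ⟨h (norm_nonneg _) ?_, norm_prod_le_iff.2 ⟨h (norm_nonneg _) ?_,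
    norm_prod_le_iff.2 ⟨h (norm_nonneg _) ?_, h (norm_nonneg _) ?_⟩⟩⟩⟩⟩
  · change ‖x.param‖ ^ 2 ≤ _; linarith
  · change ‖x.gradJ‖ ^ 2 ≤ _; linarith
  · change |x.etaJ| ^ 2 ≤ _; rw [sq_abs]; linarith
  · change ‖x.gradh‖ ^ 2 ≤ _; linarith
  · change |x.etah| ^ 2 ≤ _; rw [sq_abs]; linarith
  · change |x.gamma| ^ 2 ≤ _; rw [sq_abs]; linarith

theorem euclNorm_le (x : State n) : x.euclNorm ≤ 3 * ‖x‖ := by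
  refine Real.sqrt_le_iff.2 ⟨by positivity, ?_⟩
  have h1 : ‖x.param‖ ≤ ‖x‖ := norm_fst_le x
  have t1 : ‖x.2‖ ≤ ‖x‖ := norm_snd_le x
  have h2 : ‖x.gradJ‖ ≤ ‖x‖ := (norm_fst_le x.2).trans t1
  have t2 : ‖x.2.2‖ ≤ ‖x‖ := (norm_snd_le x.2).trans t1
  have h3 : |x.etaJ| ≤ ‖x‖ := (norm_fst_le x.2.2).trans t2
  have t3 : ‖x.2.2.2‖ ≤ ‖x‖ := (norm_snd_le x.2.2).trans t2
  have h4 : ‖x.gradh‖ ≤ ‖x‖ := (norm_fst_le x.2.2.2).trans t3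
  have t4 : ‖x.2.2.2.2‖ ≤ ‖x‖ := (norm_snd_le x.2.2.2).trans t3
  have h5 : |x.etah| ≤ ‖x‖ := (norm_fst_le x.2.2.2.2).trans t4
  have h6 : |x.gamma| ≤ ‖x‖ := (norm_snd_le x.2.2.2.2).trans t4
  have q : ∀ {y : ℝ}, 0 ≤ y → y ≤ ‖x‖ → y ^ 2 ≤ ‖x‖ ^ 2 := fun hy h => by gcongr
  have e1 := q (norm_nonneg _) h1
  have e2 := q (norm_nonneg _) h2
  have e3 := q (abs_nonneg _) h3
  have e4 := q (norm_nonneg _) h4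
  have e5 := q (abs_nonneg _) h5
  have e6 := q (abs_nonneg _) h6
  rw [sq_abs] at e3 e5 e6
  nlinarith [sq_nonneg ‖x‖]

theorem norm_pert_le {a : ℝ} (ha : 0 ≤ a) (w : Fin n → ℝ) (t : ℝ) : ‖pert a w t‖ ≤ n * a := by
  have h : pert a w t = ∑ i, (a * Real.sin (w i * t)) • EuclideanSpace.single i (1 : ℝ) := by
    ext l
    simp [Finset.sum_apply, Pi.single_apply, Data.pert_apply]
  rw [h]
  refine (norm_sum_le _ _).trans ((Finset.sum_le_sum fun i _ => ?_).trans_eq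
    (by simp : ∑ _i : Fin n, a = n * a))
  rw [norm_smul, PiLp.norm_single, norm_one, mul_one, Real.norm_eq_abs, abs_mul,
    abs_of_nonneg ha]
  exact mul_le_of_le_one_right ha (Real.abs_sin_le_one _)

end Norms

namespace Data

variable {n : ℕ} (P : Data n)

theorem field_mul_freq (a ω t : ℝ) (x : State n) :
    P.field a (fun i => ω * P.freq i) t x = P.errorField a (ω * t) (P.toError x) := by
  have h : ∀ i, ω * P.freq i * t = P.freq i * (ω * t) := fun i => by ring
  have hx : P.ofError (P.toError x) = x := by
    simp [ofError, toError, State.param]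
  rw [errorField, hx]
  simp only [field, pert, demod, h]

theorem toError_eq_sub (x : State n) : P.toError x = x - (P.θstar, 0) := by
  simp [toError, State.param, Prod.ext_iff]

end Data

end ASfES

theorem mainTheorem3 {n : ℕ} (P : ASfES.Data n)
    (hH : P.H.PosDef) (hh₁ : P.h₁ ≠ 0)
    (hk : 0 < P.k) (hc : 0 < P.c) (hδ : 0 < P.δ) (hωf : 0 < P.ωf)
    (hfreq : ∀ i, 0 < P.freq i)
    (hrat : ∀ i j, ∃ r : ℚ, P.freq i / P.freq j = (r : ℝ))
    (hne : ∀ i j, i ≠ j → P.freq i ≠ P.freq j)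
    (hsum : ∀ i j l, i ≠ j → j ≠ l → i ≠ l → P.freq i + P.freq j ≠ P.freq l) :
    ∃ K > 0, ∀ a : ℝ, 0 < a →
      (∀ x : ASfES.State n, P.avgField a x = P.avgFieldClosed a x) ∧
      ASfES.IsExpStable (P.avgField a) (P.equilibrium a) ∧
      ∃ ρ > 0, ∃ ωstar > 0, ∃ C > 0, ∀ x₀ : ASfES.State n,
        (P.toError x₀ - P.equilibrium a).euclNorm < ρ →
        ∀ ω : ℝ, ωstar ≤ ω →
          (∃ xhat : ℝ → ASfES.State n,
            ASfES.IsSolution (P.field a (fun i => ω * P.freq i)) xhat ∧ xhat 0 = x₀) ∧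
          (∃ xa : ℝ → ASfES.State n,
            ASfES.IsSolution (fun _ => P.avgField a) xa ∧ xa 0 = P.toError x₀) ∧
          ∀ xhat xa : ℝ → ASfES.State n,
            ASfES.IsSolution (P.field a (fun i => ω * P.freq i)) xhat → xhat 0 = x₀ →
            ASfES.IsSolution (fun _ => P.avgField a) xa → xa 0 = P.toError x₀ →
            ∀ t : ℝ, 0 ≤ t →
              (xa t - P.toError (xhat t)).euclNorm ≤ C / ω ∧
              ‖((xhat t).param + ASfES.pert a (fun i => ω * P.freq i) t)
                - ((xa t).param + P.θstar)‖ ≤ K * (1 / ω + a) := by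
  open ASfES in
  obtain ⟨hpos, hp⟩ := Data.period_pos_and_freq_mul_period hh₁ hfreq hrat
  refine ⟨n + 1, by positivity, fun a ha => ?_⟩
  have havg : ∀ x, P.avgField a x = P.avgFieldClosed a x :=
    Data.avgField_eq_avgFieldClosed hH hpos hp hfreq hne ha
  have heq : P.avgField a = P.avgFieldClosed a := funext havg
  have hA := Data.contDiff_avgFieldClosed hδ a
  have h0 := Data.avgFieldClosed_equilibrium hH hh₁ hk hc hδ a
  have hosc := Data.isOscillatory_errorField_sub hH hp hfreq hne ha
  obtain ⟨B, hsymm, m, hm, hco, hL⟩ :=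
    Data.exists_lyapunov_fderiv_avgFieldClosed hH hh₁ hk hc hδ hωf a
  obtain ⟨r, μ, L, hcon⟩ := exists_isContractingAt
    (hA.contDiffAt.hasStrictFDerivAt one_ne_zero) h0 hm hsymm hco hL
  refine ⟨havg, ?_, ?_⟩
  · rw [heq]
    refine ⟨h0, ?_⟩
    obtain ⟨ρ, hρ, κ, hκ, lam, hlam, hdec⟩ := hcon.exists_solution_expDecay hA
    refine ⟨ρ, hρ, 3 * κ, by positivity, lam, hlam, fun x₀ hx₀ => ?_⟩
    obtain ⟨⟨X, hX0, hX⟩, hall⟩ := hdec x₀ ((norm_le_euclNorm _).trans_lt hx₀)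
    refine ⟨⟨X, hX, hX0⟩, fun X hX hX0 t ht => ?_⟩
    calc (X t - P.equilibrium a).euclNorm ≤ 3 * ‖X t - P.equilibrium a‖ := euclNorm_le _
      _ ≤ 3 * (κ * ‖x₀ - P.equilibrium a‖ * Real.exp (-(lam * t))) := by
          gcongr; exact (hall X (.of_forall hX _) hX0 t ht).2
      _ = 3 * κ * ‖x₀ - P.equilibrium a‖ * Real.exp (-(lam * t)) := by ring
      _ ≤ _ := by gcongr; exact norm_le_euclNorm _
  · rw [heq]
    obtain ⟨ρ, hρ, ωs, hωs, C, hC, hav⟩ := hcon.exists_averaging hA hpos.ne' hosc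
    -- for `ω ≥ C / a` the averaging error `C / ω` is at most `a`, so `K` need not depend on `a`
    refine ⟨ρ, hρ, max ωs (C / a), by positivity, 3 * C, by positivity, fun x₀ hx₀ ω hω => ?_⟩
    have hωpos : 0 < ω := lt_of_lt_of_le (by positivity) hω
    obtain ⟨⟨X, hX0, hX⟩, ⟨Xa, hXa0, hXa⟩, hall⟩ := hav (P.toError x₀)
      ((norm_le_euclNorm _).trans_lt hx₀) ω ((le_max_left _ _).trans hω)
    refine ⟨⟨fun t => X t + (P.θstar, 0), fun t ht => ?_, ?_⟩, ⟨Xa, hXa, hXa0⟩, ?_⟩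
    · rw [Data.field_mul_freq, Data.toError_eq_sub, add_sub_cancel_right]
      simpa using (hX t ht).add_const (P.θstar, 0)
    · change X 0 + _ = x₀
      rw [hX0, Data.toError_eq_sub, sub_add_cancel]
    · intro xhat xa hxhat hxhat0 hxa hxa0 t ht
      have hsol : ∀ t, 0 ≤ t → HasDerivWithinAt (fun t => P.toError (xhat t))
          (P.avgFieldClosed a (P.toError (xhat t))
            + (P.errorField a (ω * t) (P.toError (xhat t))
              - P.avgFieldClosed a (P.toError (xhat t)))) (Set.Ici 0) t := fun t ht => by
        rw [add_sub_cancel, ← Data.field_mul_freq]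
        simp only [Data.toError_eq_sub]
        exact (hxhat t ht).sub_const _
      have hbound := hall _ xa hsol (by rw [hxhat0]) hxa hxa0 t ht
      refine ⟨?_, ?_⟩
      · calc _ ≤ 3 * ‖xa t - P.toError (xhat t)‖ := euclNorm_le _
          _ ≤ 3 * (C / ω) := by gcongr
          _ = _ := by ring
      · have hθ : ‖(xa t).param - ((xhat t).param - P.θstar)‖ ≤ C / ω :=
          (norm_fst_le (xa t - P.toError (xhat t))).trans hbound
        have hsplit : ((xhat t).param + pert a (fun i => ω * P.freq i) t)
            - ((xa t).param + P.θstar) = pert a (fun i => ω * P.freq i) t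
              - ((xa t).param - ((xhat t).param - P.θstar)) := by abel
        have hCa : C / ω ≤ a := by
          rw [div_le_comm₀ hωpos ha]
          exact (le_max_right _ _).trans hω
        rw [hsplit]
        calc _ ≤ _ := norm_sub_le _ _
          _ ≤ n * a + a := add_le_add (norm_pert_le ha.le _ _) (hθ.trans hCa)
          _ = (n + 1) * a := by ring
          _ ≤ (n + 1) * (1 / ω + a) := by
              gcongr
              exact le_add_of_nonneg_left (by positivity)
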